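/- **Setting.** Let $m\ge 2$ senders and one receiver interact over stages $1,\dots,n$. The state in $\mathbb R^p$ is $x_k=Ax_{k-1}+w_{k-1}$ for $1\le k\le n$, where $x_0\sim\mathbb N(0,\Sigma_0)$ and $w_0,\dots,w_{n-1}\sim\mathbb N(0,\Sigma_w)$ are independent; let $\Sigma_k=A\Sigma_{k-1}A^\top+\Sigma_w$. At stage $k$, sender $i$ sends $y^i_k=\eta^i_k(x_1,\dots,x_k)\in\mathbb R^p$ and the receiver takes the action $u_k=\gamma_k\big((y^i_l)_{i\le m,\,l\le k}\big)\in\mathbb R^t$, with Borel measurable $\eta^i_k,\gamma_k$. Each player $j\in\{1,\dots,m,r\}$ has the costs $J_j^K=\mathbb E\sum_{k=1}^K\|Q_{j,k}x_k+R_{j,k}u_k\|^2$, $1\le K\le n$, and all $R_{r,k}^\top R_{r,k}$ are invertible. The senders commit to their policies first and the receiver reacts. A profile $\eta^*$ with a receiver's reaction map $\eta\mapsto\gamma^*(\eta)$ is a *multistage Nash equilibrium* if, for every profile $\eta$ and every $K\le n$, $\gamma^*(\eta)$ minimizes $J_r^K(\eta,\cdot)$, and, for every $K\le n$, every sender $i$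 and every policy $\eta^i=(\eta^i_k)_k$ (deviations at any set of stages), $J_i^K(\eta^*,\gamma^*(\eta^*))\le J_i^K(\eta^i,\eta^{-i*},\gamma^*(\eta^i,\eta^{-i*}))$. The posterior covariance of a profile at stage $k$ is $\mathbb E[\hat x_k\hat x_k^\top]$ with $\hat x_k=\mathbb E[x_k\mid (y^i_l)_{i\le m,\,l\le k}]$. Let $\Lambda^i_k=R_{i,k}(R_{r,k}^\top R_{r,k})^{-1}R_{r,k}^\top Q_{r,k}$ and $V^i_k=\Lambda_k^{i\top}\Lambda^i_k-\Lambda_k^{i\top}Q_{i,k}-Q_{i,k}^\top\Lambda^i_k$. With $\preceq$ the Loewner order, call $S$ stable for sender $i$ at stage $k$ if $O\preceq S\preceq\Sigma_k$ and $\mathrm{Tr}(V^i_kS)=\min_{S\preceq T\preceq\Sigma_k}\mathrm{Tr}(V^i_kT)$. A sequence $S^*_0=O,S^*_1,\dots,S^*_n$ is a *sequence of stable posteriors* with orthogonal projection matrices $P_1,\dots,P_n$ if, for $1\le k\le n$, $S^*_k$ is stable at stage $k$ for every sender and $$S^*_k=AS^*_{k-1}A^\top+D_k^{1/2}P_kD_k^{1/2},\qquad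 D_k=\Sigma_k-AS^*_{k-1}A^\top .$$ **Statement.** (a) Let $S^*,P$ be a sequence of stable posteriors with its projection matrices and let $D_1,\dots,D_n$ be positive definite. For any eigen-decompositions $P_k=U_k\Lambda_kU_k^\top$ ($U_k$ orthogonal, $\Lambda_k$ diagonal), let $L_k=D_k^{-1/2}U_k\Lambda_k$ and let every sender use the same memoryless linear policy $y_k=L_k^\top x_k$. Then the posterior covariance at each stage $k=1,\dots,n$ is $S^*_k$, and this profile is a multistage Nash equilibrium together with every map that assigns to each profile a best response of the receiver (minimizing $J_r^K$ for all $K\le n$); at least one such map exists. (b) The outcomes of the greedy algorithm are such sequences: fix an order of the senders and, at each stage $k$, starting from $T_0=O$, let the senders $i$ in this order replace the current $T_{j-1}$ by a minimizer $T_j$ of $\mathrm{Tr}(V^i_kT)$ over $T_{j-1}\preceq T\preceq D_k$ that has, among the minimizers, the least nuclear norm $\|D_k^{-1/2}TD_k^{-1/2}\|_*$; put $S^*_k=AS^*_{k-1}A^\top+T_m$, with $S^*_0=O$. If all $D_k$ are positive definite, then $S^*_1,\dots,S^*_n$ are stable posteriors with some projection matrices $P_1,\dots,P_n$. -/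

import Mathlib

open MeasureTheory ProbabilityTheory
open scoped MatrixOrder Matrix ENNReal

noncomputable section

namespace Disclosure

/-- Real square matrices of size `p`. The order `≤` on them is the Loewner order. -/
abbrev Mat (p : ℕ) := Matrix (Fin p) (Fin p) ℝ

/-- Euclidean space of dimension `p`. -/
abbrev Vec (p : ℕ) := EuclideanSpace ℝ (Fin p)

/-- The data of an `m`-sender, one-receiver game of quadratic costs over the stages `1, …, n`.
The state lives in dimension `p`, the receiver's action in dimension `t`.
Only the values of the cost matrices at the stages `1, …, n` are ever used. -/
structure Game (m p t q : ℕ) where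
  /-- the number of stages -/
  n : ℕ
  /-- the matrix of the state dynamics -/
  A : Mat p
  /-- the covariance of the initial state -/
  covInit : Mat p
  /-- the covariance of the noise -/
  covNoise : Mat p
  /-- the senders' cost matrices on the state: sender, stage -/
  Q : Fin m → ℕ → Matrix (Fin q) (Fin p) ℝ
  /-- the senders' cost matrices on the action: sender, stage -/
  R : Fin m → ℕ → Matrix (Fin q) (Fin t) ℝ
  /-- the receiver's cost matrices on the state -/
  Qr : ℕ → Matrix (Fin q) (Fin p) ℝ
  /-- the receiver's cost matrices on the action -/
  Rr : ℕ → Matrix (Fin q) (Fin t) ℝ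
  covInit_psd : covInit.PosSemidef
  covNoise_psd : covNoise.PosSemidef
  Rr_invertible : ∀ k ∈ Finset.Icc 1 n, IsUnit ((Rr k)ᵀ * Rr k)

variable {m p t q : ℕ}

namespace Game

/-- The covariance of the state, by the Lyapunov recursion. -/
def stateCov (G : Game m p t q) : ℕ → Mat p
  | 0 => G.covInit
  | k + 1 => G.A * G.stateCov k * G.Aᵀ + G.covNoise

/-- The matrix `R_i (R_rᵀ R_r)⁻¹ R_rᵀ Q_r` of stage `k`: when the receiver best responds to its
estimate `x̂` of the state, the term `R_i u` in the cost of sender `i` is `-(gain) x̂`. -/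
def gain (G : Game m p t q) (i : Fin m) (k : ℕ) : Matrix (Fin q) (Fin p) ℝ :=
  G.R i k * ((G.Rr k)ᵀ * G.Rr k)⁻¹ * (G.Rr k)ᵀ * G.Qr k

/-- The matrix of sender `i`'s stage cost as a linear function of the posterior covariance. -/
def V (G : Game m p t q) (i : Fin m) (k : ℕ) : Mat p :=
  (G.gain i k)ᵀ * G.gain i k - (G.gain i k)ᵀ * G.Q i k - (G.Q i k)ᵀ * G.gain i k

/-- Given posterior covariances `S`, the matrix `Σ_{k+1} - A S_k Aᵀ` of stage `k + 1`. -/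
def innovCov (G : Game m p t q) (S : ℕ → Mat p) (k : ℕ) : Mat p :=
  G.stateCov (k + 1) - G.A * S k * G.Aᵀ

end Game

/-! ### Stable posteriors -/

/-- The covariance `S` is a stable posterior for a sender with matrix `V` and prior covariance
`Sx`: it minimizes `Tr(V T)` among the `T` with `S ≤ T ≤ Sx`. -/
def IsStable (Sx V S : Mat p) : Prop :=
  0 ≤ S ∧ S ≤ Sx ∧ ∀ T : Mat p, S ≤ T → T ≤ Sx → (V * S).trace ≤ (V * T).trace

/-- `S 1, …, S n` are stable posteriors of the dynamic game, with corresponding (orthogonal)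
projection matrices `P 1, …, P n`. -/
structure IsStablePosteriorSeq (G : Game m p t q) (S P : ℕ → Mat p) : Prop where
  zero : S 0 = 0
  proj : ∀ k ∈ Finset.Icc 1 G.n, (P k)ᵀ = P k ∧ P k * P k = P k
  recursion : ∀ k < G.n, S (k + 1) = G.A * S k * G.Aᵀ
    + CFC.sqrt (G.innovCov S k) * P (k + 1) * CFC.sqrt (G.innovCov S k)
  stable : ∀ k ∈ Finset.Icc 1 G.n, ∀ i, IsStable (G.stateCov k) (G.V i k) (S k)

/-! ### The greedy sequential algorithm -/

/-- The nuclear norm (the sum of the singular values) of a real square matrix. -/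
def nuclearNorm (M : Mat p) : ℝ := (CFC.sqrt (Mᵀ * M)).trace

/-- `T` is an outcome of the step of a sender with matrix `V`, started from `S`: it minimizes
`Tr(V T)` over `S ≤ T ≤ Sx` and, among the minimizers, has the least normalized nuclear norm. -/
def IsStep (Sx V S T : Mat p) : Prop :=
  S ≤ T ∧ T ≤ Sx ∧ (∀ T', S ≤ T' → T' ≤ Sx → (V * T).trace ≤ (V * T').trace) ∧
    ∀ T', S ≤ T' → T' ≤ Sx → (V * T').trace ≤ (V * T).trace →
      nuclearNorm ((CFC.sqrt Sx)⁻¹ * T * (CFC.sqrt Sx)⁻¹)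
        ≤ nuclearNorm ((CFC.sqrt Sx)⁻¹ * T' * (CFC.sqrt Sx)⁻¹)

/-- `S` is an outcome of the single-stage algorithm with prior covariance `Sx`, in which the
senders with matrices `V i` make one step each, in the order `o`, started from `0`. -/
def IsStageOutput (Sx : Mat p) (V : Fin m → Mat p) (o : Equiv.Perm (Fin m)) (S : Mat p) : Prop :=
  ∃ T : Fin (m + 1) → Mat p, T 0 = 0 ∧
    (∀ j : Fin m, IsStep Sx (V (o j)) (T j.castSucc) (T j.succ)) ∧ T (Fin.last m) = S

/-- `S` is an outcome of the multistage algorithm, which at each stage runs the single-stage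
algorithm on the part of the state that the past signals leave unexplained. -/
def IsGreedyOutput (G : Game m p t q) (o : Equiv.Perm (Fin m)) (S : ℕ → Mat p) : Prop :=
  S 0 = 0 ∧ ∀ k < G.n, IsStageOutput (G.innovCov S k) (fun i => G.V i (k + 1)) o
    (S (k + 1) - G.A * S k * G.Aᵀ)

/-! ### The state process, policies and costs -/

variable {Ω : Type*} [MeasurableSpace Ω]

/-- `x` is the Gaussian Markov state process driven by the noise `w`, up to time `n`. -/
structure IsStateProcess (G : Game m p t q) (μ : Measure Ω) (x w : ℕ → Ω → Vec p) : Prop where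
  measurable_init : Measurable (x 0)
  measurable_noise : ∀ k < G.n, Measurable (w k)
  law_init : HasLaw (x 0) (multivariateGaussian 0 G.covInit) μ
  law_noise : ∀ k < G.n, HasLaw (w k) (multivariateGaussian 0 G.covNoise) μ
  indep : iIndepFun (Fin.cons (x 0) (fun k : Fin G.n => w k) : Fin (G.n + 1) → Ω → Vec p) μ
  dynamics : ∀ k < G.n, ∀ ω, x (k + 1) ω = Matrix.toEuclideanLin G.A (x k ω) + w k ω

/-- A sender's policy: at each stage `k`, a Borel function of the states `x_1, …, x_k`. -/
structure SenderPolicy (p : ℕ) where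
  toFun : (k : ℕ) → (Finset.Icc 1 k → Vec p) → Vec p
  measurable : ∀ k, Measurable (toFun k)

/-- The receiver's policy: at each stage `k`, a Borel function of all the signals of the stages
`1, …, k`. -/
structure ReceiverPolicy (m p t : ℕ) where
  toFun : (k : ℕ) → (Fin m → Finset.Icc 1 k → Vec p) → Vec t
  measurable : ∀ k, Measurable (toFun k)

/-- A policy for each sender. -/
abbrev Profile (m p : ℕ) := Fin m → SenderPolicy p

/-- The signal of a sender at stage `k`. -/
def signal (η : SenderPolicy p) (x : ℕ → Ω → Vec p) (k : ℕ) (ω : Ω) : Vec p :=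
  η.toFun k (fun j => x j ω)

/-- The receiver's information at stage `k`: all the senders' signals of the stages `1, …, k`. -/
def info (η : Profile m p) (x : ℕ → Ω → Vec p) (k : ℕ) (ω : Ω) : Fin m → Finset.Icc 1 k → Vec p :=
  fun i j => signal (η i) x j ω

/-- The receiver's action at stage `k`. -/
def action (η : Profile m p) (γ : ReceiverPolicy m p t) (x : ℕ → Ω → Vec p) (k : ℕ) (ω : Ω) :
    Vec t :=
  γ.toFun k (info η x k ω)

/-- The expected cost `E[∑_{k ≤ K} ‖Q_k x_k + R_k u_k‖²]` of the first `K` stages, possibly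
infinite. -/
def cost (μ : Measure Ω) (x : ℕ → Ω → Vec p) (Q : ℕ → Matrix (Fin q) (Fin p) ℝ)
    (R : ℕ → Matrix (Fin q) (Fin t) ℝ) (K : ℕ) (η : Profile m p) (γ : ReceiverPolicy m p t) :
    ℝ≥0∞ :=
  ∫⁻ ω, ∑ k ∈ Finset.Icc 1 K, ENNReal.ofReal
    (‖Matrix.toEuclideanLin (Q k) (x k ω) + Matrix.toEuclideanLin (R k) (action η γ x k ω)‖ ^ 2) ∂μ

/-- The receiver's estimate `E[x_k | signals up to stage k]`. -/
def estimate (μ : Measure Ω) (x : ℕ → Ω → Vec p) (η : Profile m p) (k : ℕ) : Ω → Vec p :=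
  μ[x k | MeasurableSpace.comap (info η x k) inferInstance]

/-- The posterior covariance `E[x̂_k x̂_kᵀ]`. -/
def posteriorCov (μ : Measure Ω) (x : ℕ → Ω → Vec p) (η : Profile m p) (k : ℕ) : Mat p :=
  Matrix.of fun a b => ∫ ω, estimate μ x η k ω a * estimate μ x η k ω b ∂μ

/-- `γ` is a best response of the receiver to the announced policies `η`, at every horizon. -/
def IsBestResponse (G : Game m p t q) (μ : Measure Ω) (x : ℕ → Ω → Vec p)
    (η : Profile m p) (γ : ReceiverPolicy m p t) : Prop :=
  ∀ K ∈ Finset.Icc 1 G.n, ∀ γ' : ReceiverPolicy m p t,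
    cost μ x G.Qr G.Rr K η γ ≤ cost μ x G.Qr G.Rr K η γ'

/-- `(η, γ)` is a multistage hierarchical Nash equilibrium: the receiver's strategy `γ` reacts to
every profile by a best response, and at no horizon does a sender gain by a unilateral deviation,
which may change its policy at any set of stages and to which the receiver reacts. -/
structure IsMultistageNash (G : Game m p t q) (μ : Measure Ω) (x : ℕ → Ω → Vec p)
    (η : Profile m p) (γ : Profile m p → ReceiverPolicy m p t) : Prop where
  receiver : ∀ η', IsBestResponse G μ x η' (γ η')
  sender : ∀ K ∈ Finset.Icc 1 G.n, ∀ (i : Fin m) (ηi : SenderPolicy p),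
    cost μ x (G.Q i) (G.R i) K η (γ η)
      ≤ cost μ x (G.Q i) (G.R i) K (Function.update η i ηi) (γ (Function.update η i ηi))

/-- The memoryless linear policy that sends `(L k)ᵀ x_k` at stage `k`. -/
def linearPolicy (L : ℕ → Mat p) : SenderPolicy p where
  toFun k xs := if h : k ∈ Finset.Icc 1 k then Matrix.toEuclideanLin (L k)ᵀ (xs ⟨k, h⟩) else 0
  measurable k := by
    by_cases h : k ∈ Finset.Icc 1 k
    · simp only [h, dite_true]
      exact (LinearMap.continuous_of_finiteDimensional _).measurable.comp (measurable_pi_apply _)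
    · simp only [h, dite_false]
      exact measurable_const

end Disclosure

end

/-!
Conjugation by `D^{-1/2}` turns the order interval `[0, D]` into `[0, 1]`. If `P` is a projection
and `N` minimizes a linear functional over `[P, 1]`, then `N ^ 2` and `2 N - N ^ 2` also lie in
`[P, 1]` and average to `N`, so both are minimizers; since `Tr N ^ 2 ≤ Tr N`, least trace forces
`N ^ 2 = N`. Hence each greedy step leads from a projection to a projection, and it keeps the
stability obtained by the senders before.

For the equilibrium, a best response of the receiver makes the cost of sender `i` at stage `k` a
constant plus `Tr (V S)`, where `S` is the posterior covariance. As all the senders use one policy,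
a unilateral deviation only adds information, which can only increase `S`, and stability says that
no sender gains from this.

The posterior covariance of the linear policy is found by a Kalman filter with the gains
`H = D^{1/2} P D^{-1/2}`. The filter is a function of the signals, and its error is uncorrelated
with them, hence independent of them since everything is jointly Gaussian; so the filter is the
conditional expectation. Its covariance obeys the recursion of the stable posteriors because
`H D Hᵀ = D^{1/2} P D^{1/2}`.
-/

namespace Disclosure

section Projections

theorem mul_self_le_self_of_nonneg_of_le_one {R : Type*} [Ring R] [PartialOrder R] [StarRing R]
    [StarOrderedRing R] {a : R} (ha : 0 ≤ a) (ha' : a ≤ 1) : a * a ≤ a := by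
  have h₁ : 0 ≤ a * (1 - a) * a := conjugate_nonneg_of_nonneg (sub_nonneg.2 ha') ha
  have h₂ : 0 ≤ (1 - a) * a * (1 - a) := conjugate_nonneg_of_nonneg ha (sub_nonneg.2 ha')
  rw [← sub_nonneg]
  convert add_nonneg h₁ h₂ using 1
  noncomm_ring

theorem self_add_sub_mul_self_le_one {R : Type*} [Ring R] [PartialOrder R] [StarRing R]
    [StarOrderedRing R] {a : R} (ha : IsSelfAdjoint a) : a + (a - a * a) ≤ 1 := by
  rw [← sub_nonneg]
  convert ((IsSelfAdjoint.one R).sub ha).mul_self_nonneg using 1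
  noncomm_ring

variable {ι : Type*} {D M N P W : Matrix ι ι ℝ}

theorem isSelfAdjoint_iff_transpose_eq : IsSelfAdjoint M ↔ Mᵀ = M := by
  rw [isSelfAdjoint_iff, Matrix.star_eq_conjTranspose,
    Matrix.conjTranspose_eq_transpose_of_trivial]

theorem transpose_eq_of_nonneg (h : 0 ≤ M) : Mᵀ = M :=
  isSelfAdjoint_iff_transpose_eq.1 (Matrix.nonneg_iff_posSemidef.1 h).isHermitian

variable [Fintype ι]

theorem mul_mul_transpose_nonneg {κ : Type*} [Finite κ] (hM : 0 ≤ M) (B : Matrix κ ι ℝ) :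
    0 ≤ B * M * Bᵀ := by
  rw [← Matrix.conjTranspose_eq_transpose_of_trivial]
  exact ((Matrix.nonneg_iff_posSemidef.1 hM).mul_mul_conjTranspose_same B).nonneg

theorem trace_le_trace (h : M ≤ N) : M.trace ≤ N.trace :=
  OrderHomClass.mono (Matrix.tracePositiveLinearMap ι ℝ ℝ) h

variable [DecidableEq ι]

theorem mul_eq_left_of_isStarProjection_of_le (hP : IsStarProjection P) (hPN : P ≤ N)
    (hN : N ≤ 1) : P * N = P := by
  have hPN' : P * (1 - N) * P = 0 := by
    refine le_antisymm ?_ (conjugate_nonneg_of_nonneg (sub_nonneg.2 hN) hP.nonneg)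
    have := conjugate_le_conjugate_of_nonneg (sub_le_sub_left hPN 1) hP.nonneg
    rwa [hP.mul_one_sub_self, zero_mul] at this
  have hsqrt : CFC.sqrt (1 - N) * P = 0 := by
    rw [← Matrix.conjTranspose_mul_self_eq_zero, Matrix.conjTranspose_mul,
      ← Matrix.star_eq_conjTranspose, ← Matrix.star_eq_conjTranspose, hP.isSelfAdjoint.star_eq,
      (CFC.sqrt_nonneg (1 - N)).star_eq, mul_assoc, ← mul_assoc (CFC.sqrt (1 - N)),
      CFC.sqrt_mul_sqrt_self (1 - N) (sub_nonneg.2 hN), ← mul_assoc, hPN']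
  have hsub : (1 - N) * P = 0 := by
    rw [← CFC.sqrt_mul_sqrt_self (1 - N) (sub_nonneg.2 hN), mul_assoc, hsqrt, mul_zero]
  have hNP : N * P = P := by rwa [sub_mul, one_mul, sub_eq_zero, eq_comm] at hsub
  simpa [hP.isSelfAdjoint.star_eq, (hP.nonneg.trans hPN).star_eq] using congrArg star hNP

theorem le_mul_self_of_isStarProjection_of_le (hP : IsStarProjection P) (hPN : P ≤ N)
    (hN : N ≤ 1) : P ≤ N * N := by
  have hNsa := IsSelfAdjoint.of_nonneg (hP.nonneg.trans hPN)
  have hPN' : P * N = P := mul_eq_left_of_isStarProjection_of_le hP hPN hN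
  have hNP : N * P = P := by
    simpa [hP.isSelfAdjoint.star_eq, hNsa.star_eq] using congrArg star hPN'
  have hsq : (N - P) * (N - P) = N * N - P := by
    rw [mul_sub, sub_mul, sub_mul, hPN', hNP, hP.isIdempotentElem, sub_self, sub_zero]
  exact sub_nonneg.1 (hsq ▸ (hNsa.sub hP.isSelfAdjoint).mul_self_nonneg)

/- Minimality against `2 N - N²` gives `tr (W N²) ≤ tr (W N)`, so `N²` is a minimizer as well and
`tr N ≤ tr N²`, which together with `N² ≤ N` forces `N² = N`. -/
theorem isStarProjection_of_least_trace (hP : IsStarProjection P) (hPN : P ≤ N) (hN : N ≤ 1)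
    (hmin : ∀ N', P ≤ N' → N' ≤ 1 → (W * N).trace ≤ (W * N').trace)
    (hleast : ∀ N', P ≤ N' → N' ≤ 1 → (W * N').trace ≤ (W * N).trace → N.trace ≤ N'.trace) :
    IsStarProjection N := by
  have hN₀ : 0 ≤ N := hP.nonneg.trans hPN
  have hsq : N * N ≤ N := mul_self_le_self_of_nonneg_of_le_one hN₀ hN
  have htrace_sq : (W * (N * N)).trace ≤ (W * N).trace := by
    have := hmin (N + (N - N * N)) (hPN.trans (le_add_of_nonneg_right (sub_nonneg.2 hsq)))
      (self_add_sub_mul_self_le_one (.of_nonneg hN₀))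
    rw [mul_add, mul_sub, Matrix.trace_add, Matrix.trace_sub] at this
    linarith
  have hle : N.trace ≤ (N * N).trace :=
    hleast _ (le_mul_self_of_isStarProjection_of_le hP hPN hN) (hsq.trans hN) htrace_sq
  have htrace : (N - N * N).trace = 0 := by
    rw [Matrix.trace_sub, sub_eq_zero]
    exact hle.antisymm (trace_le_trace hsq)
  refine ⟨?_, .of_nonneg hN₀⟩
  exact (sub_eq_zero.1 ((Matrix.le_iff.1 hsq).trace_eq_zero_iff.1 htrace)).symm

theorem sqrt_mul_inv_sqrt (hD : D.PosDef) : CFC.sqrt D * (CFC.sqrt D)⁻¹ = 1 := by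
  have hunit : IsUnit (CFC.sqrt D) :=
    CFC.isUnit_sqrt_iff D hD.posSemidef.nonneg |>.2 hD.isUnit
  exact Matrix.mul_nonsing_inv _ ((Matrix.isUnit_iff_isUnit_det _).1 hunit)

theorem inv_sqrt_mul_sqrt (hD : D.PosDef) : (CFC.sqrt D)⁻¹ * CFC.sqrt D = 1 :=
  mul_eq_one_comm.1 (sqrt_mul_inv_sqrt hD)

theorem inv_sqrt_nonneg (D : Matrix ι ι ℝ) : 0 ≤ (CFC.sqrt D)⁻¹ :=
  (Matrix.nonneg_iff_posSemidef.1 (CFC.sqrt_nonneg D)).inv.nonneg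

/-- The normalization `D^{-1/2} T D^{-1/2}` of `T` by a positive definite matrix `D`: it carries
the Loewner interval `[0, D]` onto `[0, 1]`. -/
noncomputable def whiten (D T : Matrix ι ι ℝ) : Matrix ι ι ℝ := (CFC.sqrt D)⁻¹ * T * (CFC.sqrt D)⁻¹

theorem whiten_mono (D : Matrix ι ι ℝ) : Monotone (whiten D) := fun _ _ h =>
  conjugate_le_conjugate_of_nonneg h (inv_sqrt_nonneg D)

theorem sqrt_mul_whiten_mul_sqrt (hD : D.PosDef) (X : Matrix ι ι ℝ) :
    CFC.sqrt D * whiten D X * CFC.sqrt D = X := by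
  rw [whiten, mul_assoc, mul_assoc, inv_sqrt_mul_sqrt hD, mul_one, ← mul_assoc,
    sqrt_mul_inv_sqrt hD, one_mul]

theorem whiten_sqrt_mul_mul_sqrt (hD : D.PosDef) (X : Matrix ι ι ℝ) :
    whiten D (CFC.sqrt D * X * CFC.sqrt D) = X := by
  rw [whiten, mul_assoc, mul_assoc, sqrt_mul_inv_sqrt hD, mul_one, ← mul_assoc,
    inv_sqrt_mul_sqrt hD, one_mul]

theorem sqrt_mul_one_mul_sqrt (hD : 0 ≤ D) : CFC.sqrt D * 1 * CFC.sqrt D = D := by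
  rw [mul_one, CFC.sqrt_mul_sqrt_self D hD]

theorem whiten_self (hD : D.PosDef) : whiten D D = 1 := by
  have := whiten_sqrt_mul_mul_sqrt hD 1
  rwa [sqrt_mul_one_mul_sqrt hD.posSemidef.nonneg] at this

theorem trace_sqrt_mul_mul_sqrt_mul (V D X : Matrix ι ι ℝ) :
    (CFC.sqrt D * V * CFC.sqrt D * X).trace = (V * (CFC.sqrt D * X * CFC.sqrt D)).trace := by
  rw [mul_assoc, mul_assoc, Matrix.trace_mul_comm]
  simp only [mul_assoc]

theorem nuclearNorm_of_nonneg {p : ℕ} {M : Mat p} (h : 0 ≤ M) : nuclearNorm M = M.trace := by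
  rw [nuclearNorm, transpose_eq_of_nonneg h, CFC.sqrt_mul_self M h]

end Projections

section Greedy

variable {m p t q : ℕ} {Sx V S T : Mat p}

theorem IsStable.mono {S' : Mat p} (h : IsStable Sx V S) (hS' : S ≤ S') (hSx : S' ≤ Sx) :
    IsStable Sx V S' := by
  refine ⟨h.1.trans hS', hSx, fun T hT hTSx => ?_⟩
  have hle : S + (T - S') ≤ Sx := by
    rw [add_sub_left_comm]
    exact (add_le_of_nonpos_right (sub_nonpos.2 hS')).trans hTSx
  have := h.2.2 (S + (T - S')) (le_add_of_nonneg_right (sub_nonneg.2 hT)) hle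
  rw [mul_add, mul_sub, Matrix.trace_add, Matrix.trace_sub] at this
  linarith

theorem IsStable.add_right {B : Mat p} (h : IsStable Sx V S) (hB : 0 ≤ B) :
    IsStable (Sx + B) V (S + B) := by
  refine ⟨add_nonneg h.1 hB, add_le_add_left h.2.1 B, fun T hT hTSx => ?_⟩
  have := h.2.2 (T - B) (le_sub_iff_add_le.2 hT) (sub_le_iff_le_add.2 hTSx)
  rw [mul_sub, Matrix.trace_sub] at this
  rw [mul_add, Matrix.trace_add]
  linarith

theorem IsStep.isStable (h : IsStep Sx V S T) (hS : 0 ≤ S) : IsStable Sx V T :=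
  ⟨hS.trans h.1, h.2.1, fun T' hT' hSx => h.2.2.1 T' (h.1.trans hT') hSx⟩

theorem IsStep.isStarProjection_whiten (h : IsStep Sx V S T) (hSx : Sx.PosDef)
    (hS : IsStarProjection (whiten Sx S)) : IsStarProjection (whiten Sx T) := by
  obtain ⟨hST, hTSx, hmin, hleast⟩ := h
  have feasible {N : Mat p} (hSN : whiten Sx S ≤ N) (hN : N ≤ 1) :
      S ≤ CFC.sqrt Sx * N * CFC.sqrt Sx ∧ CFC.sqrt Sx * N * CFC.sqrt Sx ≤ Sx := by
    have h₁ := conjugate_le_conjugate_of_nonneg hSN (CFC.sqrt_nonneg Sx)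
    have h₂ := conjugate_le_conjugate_of_nonneg hN (CFC.sqrt_nonneg Sx)
    rw [sqrt_mul_whiten_mul_sqrt hSx] at h₁
    rw [sqrt_mul_one_mul_sqrt hSx.posSemidef.nonneg] at h₂
    exact ⟨h₁, h₂⟩
  refine isStarProjection_of_least_trace (W := CFC.sqrt Sx * V * CFC.sqrt Sx) hS
    (whiten_mono Sx hST) (whiten_self hSx ▸ whiten_mono Sx hTSx) ?_ ?_
  · intro N hSN hN
    rw [trace_sqrt_mul_mul_sqrt_mul, trace_sqrt_mul_mul_sqrt_mul, sqrt_mul_whiten_mul_sqrt hSx]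
    exact hmin _ (feasible hSN hN).1 (feasible hSN hN).2
  · intro N hSN hN hle
    rw [trace_sqrt_mul_mul_sqrt_mul, trace_sqrt_mul_mul_sqrt_mul,
      sqrt_mul_whiten_mul_sqrt hSx] at hle
    have : nuclearNorm (whiten Sx T) ≤ nuclearNorm (whiten Sx _) :=
      hleast _ (feasible hSN hN).1 (feasible hSN hN).2 hle
    rwa [whiten_sqrt_mul_mul_sqrt hSx, nuclearNorm_of_nonneg (hS.nonneg.trans hSN),
      nuclearNorm_of_nonneg (hS.nonneg.trans (whiten_mono Sx hST))] at this

variable {Vs : Fin m → Mat p} {o : Equiv.Perm (Fin m)}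

theorem IsStageOutput.nonneg (h : IsStageOutput Sx Vs o S) : 0 ≤ S := by
  obtain ⟨T, hT₀, hstep, rfl⟩ := h
  have hmono : Monotone T := Fin.monotone_iff_le_succ.2 fun j => (hstep j).1
  exact hT₀ ▸ hmono (Fin.zero_le _)

theorem IsStageOutput.isStarProjection_whiten (h : IsStageOutput Sx Vs o S) (hSx : Sx.PosDef) :
    IsStarProjection (whiten Sx S) := by
  obtain ⟨T, hT₀, hstep, rfl⟩ := h
  induction Fin.last m using Fin.induction with
  | zero => simp [hT₀, whiten, IsStarProjection.zero]
  | succ j ih => exact (hstep j).isStarProjection_whiten hSx ih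

/- The covariance left by a sender's own step is stable for it, and remains so when the later
senders increase it. -/
theorem IsStageOutput.isStable (h : IsStageOutput Sx Vs o S) (i : Fin m) :
    IsStable Sx (Vs i) S := by
  obtain ⟨T, hT₀, hstep, rfl⟩ := h
  have hmono : Monotone T := Fin.monotone_iff_le_succ.2 fun j => (hstep j).1
  have hle : T (Fin.last m) ≤ Sx := by
    cases m with
    | zero => exact i.elim0
    | succ m => exact Fin.succ_last m ▸ (hstep (Fin.last m)).2.1
  have hi : IsStable Sx (Vs i) (T (o.symm i).succ) := by
    have := (hstep (o.symm i)).isStable (hT₀ ▸ hmono (Fin.zero_le _))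
    rwa [o.apply_symm_apply] at this
  exact hi.mono (hmono (Fin.le_last _)) hle

variable {G : Game m p t q}

theorem IsGreedyOutput.nonneg {S : ℕ → Mat p} (h : IsGreedyOutput G o S) :
    ∀ k ≤ G.n, 0 ≤ S k
  | 0, _ => h.1.ge
  | k + 1, hk =>
    (mul_mul_transpose_nonneg (h.nonneg k (by lia)) G.A).trans
      (sub_nonneg.1 (h.2 k hk).nonneg)

theorem IsGreedyOutput.exists_isStablePosteriorSeq {S : ℕ → Mat p} (h : IsGreedyOutput G o S)
    (hD : ∀ k < G.n, (G.innovCov S k).PosDef) : ∃ P : ℕ → Mat p, IsStablePosteriorSeq G S P := by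
  refine ⟨fun k => whiten (G.innovCov S (k - 1)) (S k - G.A * S (k - 1) * G.Aᵀ), h.1, ?_, ?_, ?_⟩
  · rintro (_ | k) hk
    · simp at hk
    have hproj := (h.2 k (by grind)).isStarProjection_whiten (hD k (by grind))
    exact ⟨isSelfAdjoint_iff_transpose_eq.1 hproj.isSelfAdjoint, hproj.isIdempotentElem⟩
  · intro k hk
    rw [Nat.add_sub_cancel, sqrt_mul_whiten_mul_sqrt (hD k hk), add_sub_cancel]
  · rintro (_ | k) hk i
    · simp at hk
    have hprior : 0 ≤ G.A * S k * G.Aᵀ := mul_mul_transpose_nonneg (h.nonneg k (by grind)) G.A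
    have := ((h.2 k (by grind)).isStable i).add_right hprior
    rwa [Game.innovCov, sub_add_cancel, sub_add_cancel] at this

end Greedy

section CrossMoment

variable {Ω : Type*} {mΩ : MeasurableSpace Ω} {μ : Measure Ω} {ι κ τ : Type*}

/-- The matrix `E[X Yᵀ]` of the mixed second moments of two random vectors. It is meaningful for
square integrable vectors, on which it is bilinear; no centring is involved. -/
noncomputable def crossMoment (μ : Measure Ω) (X : Ω → EuclideanSpace ℝ ι)
    (Y : Ω → EuclideanSpace ℝ κ) : Matrix ι κ ℝ :=
  Matrix.of fun i j => ∫ ω, X ω i * Y ω j ∂μ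

theorem crossMoment_apply (X : Ω → EuclideanSpace ℝ ι) (Y : Ω → EuclideanSpace ℝ κ) (i : ι)
    (j : κ) : crossMoment μ X Y i j = ∫ ω, X ω i * Y ω j ∂μ := rfl

theorem crossMoment_transpose (X : Ω → EuclideanSpace ℝ ι) (Y : Ω → EuclideanSpace ℝ κ) :
    (crossMoment μ X Y)ᵀ = crossMoment μ Y X := by
  ext i j
  simp only [Matrix.transpose_apply, crossMoment_apply, mul_comm]

theorem crossMoment_congr {X X' : Ω → EuclideanSpace ℝ ι} {Y Y' : Ω → EuclideanSpace ℝ κ}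
    (hX : X =ᵐ[μ] X') (hY : Y =ᵐ[μ] Y') : crossMoment μ X Y = crossMoment μ X' Y' := by
  ext i j
  refine integral_congr_ae ?_
  filter_upwards [hX, hY] with ω hXω hYω
  rw [hXω, hYω]

theorem crossMoment_zero_left (Y : Ω → EuclideanSpace ℝ κ) :
    crossMoment μ (0 : Ω → EuclideanSpace ℝ ι) Y = 0 := by
  ext i j
  simp [crossMoment_apply]

theorem crossMoment_zero_right (X : Ω → EuclideanSpace ℝ ι) :
    crossMoment μ X (0 : Ω → EuclideanSpace ℝ κ) = 0 := by
  rw [← crossMoment_transpose, crossMoment_zero_left, Matrix.transpose_zero]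

variable [Fintype ι] [Fintype κ]
  {X X' : Ω → EuclideanSpace ℝ ι} {Y Y' : Ω → EuclideanSpace ℝ κ}

theorem integrable_apply_mul_apply (hX : MemLp X 2 μ) (hY : MemLp Y 2 μ) (i : ι) (j : κ) :
    Integrable (fun ω => X ω i * Y ω j) μ :=
  (hX.eval_piLp i).integrable_mul (hY.eval_piLp j)

theorem crossMoment_add_left (hX : MemLp X 2 μ) (hX' : MemLp X' 2 μ) (hY : MemLp Y 2 μ) :
    crossMoment μ (X + X') Y = crossMoment μ X Y + crossMoment μ X' Y := by
  ext i j
  simp only [Matrix.add_apply, crossMoment_apply, Pi.add_apply, PiLp.add_apply, add_mul]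
  exact integral_add (integrable_apply_mul_apply hX hY i j) (integrable_apply_mul_apply hX' hY i j)

theorem crossMoment_add_right (hX : MemLp X 2 μ) (hY : MemLp Y 2 μ) (hY' : MemLp Y' 2 μ) :
    crossMoment μ X (Y + Y') = crossMoment μ X Y + crossMoment μ X Y' := by
  rw [← crossMoment_transpose, crossMoment_add_left hY hY' hX, Matrix.transpose_add,
    crossMoment_transpose, crossMoment_transpose]

theorem crossMoment_sub_left (hX : MemLp X 2 μ) (hX' : MemLp X' 2 μ) (hY : MemLp Y 2 μ) :
    crossMoment μ (X - X') Y = crossMoment μ X Y - crossMoment μ X' Y := by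
  rw [eq_sub_iff_add_eq, ← crossMoment_add_left (hX.sub hX') hX' hY, sub_add_cancel]

theorem crossMoment_sub_right (hX : MemLp X 2 μ) (hY : MemLp Y 2 μ) (hY' : MemLp Y' 2 μ) :
    crossMoment μ X (Y - Y') = crossMoment μ X Y - crossMoment μ X Y' := by
  rw [eq_sub_iff_add_eq, ← crossMoment_add_right hX (hY.sub hY') hY', sub_add_cancel]

theorem memLp_toEuclideanLin_comp [Fintype τ] [DecidableEq ι] (hX : MemLp X 2 μ)
    (M : Matrix τ ι ℝ) : MemLp (M.toEuclideanLin ∘ X) 2 μ :=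
  M.toEuclideanLin.toContinuousLinearMap.comp_memLp' hX

theorem crossMoment_toEuclideanLin_left [DecidableEq ι] (hX : MemLp X 2 μ) (hY : MemLp Y 2 μ)
    (M : Matrix τ ι ℝ) : crossMoment μ (M.toEuclideanLin ∘ X) Y = M * crossMoment μ X Y := by
  ext i j
  simp only [Matrix.mul_apply, crossMoment_apply, Function.comp_apply,
    Matrix.ofLp_toLpLin, Matrix.toLin'_apply, Matrix.mulVec, dotProduct, Finset.sum_mul]
  rw [integral_finsetSum]
  · simp only [mul_assoc, integral_const_mul]
  · intro l _
    simpa only [mul_assoc] using (integrable_apply_mul_apply hX hY l j).const_mul (M i l)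

theorem crossMoment_toEuclideanLin_right [DecidableEq κ] (hX : MemLp X 2 μ) (hY : MemLp Y 2 μ)
    (M : Matrix τ κ ℝ) : crossMoment μ X (M.toEuclideanLin ∘ Y) = crossMoment μ X Y * Mᵀ := by
  rw [← crossMoment_transpose, crossMoment_toEuclideanLin_left hY hX, Matrix.transpose_mul,
    crossMoment_transpose]

theorem crossMoment_toEuclideanLin_self [Finite τ] [DecidableEq ι] (hX : MemLp X 2 μ)
    (M : Matrix τ ι ℝ) :
    crossMoment μ (M.toEuclideanLin ∘ X) (M.toEuclideanLin ∘ X) = M * crossMoment μ X X * Mᵀ := by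
  have := Fintype.ofFinite τ
  rw [crossMoment_toEuclideanLin_right (memLp_toEuclideanLin_comp hX M) hX,
    crossMoment_toEuclideanLin_left hX hX]

theorem crossMoment_self_nonneg (hX : MemLp X 2 μ) : 0 ≤ crossMoment μ X X := by
  have hgram : crossMoment μ X X = Matrix.gram ℝ fun i => (hX.eval_piLp i).toLp := by
    ext i j
    rw [crossMoment_apply, Matrix.gram_apply, L2.inner_def]
    refine integral_congr_ae ?_
    filter_upwards [(hX.eval_piLp i).coeFn_toLp, (hX.eval_piLp j).coeFn_toLp] with ω hi hj
    simp only [hi, hj, RCLike.inner_apply, conj_trivial, mul_comm]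
  exact hgram ▸ (Matrix.posSemidef_gram ℝ _).nonneg

theorem crossMoment_add_self (hX : MemLp X 2 μ) (hX' : MemLp X' 2 μ) :
    crossMoment μ (X + X') (X + X') = crossMoment μ X X + crossMoment μ X X' +
      ((crossMoment μ X X')ᵀ + crossMoment μ X' X') := by
  rw [crossMoment_add_left hX hX' (hX.add hX'), crossMoment_add_right hX hX hX',
    crossMoment_add_right hX' hX hX', crossMoment_transpose]

theorem crossMoment_add_self_of_eq_zero (hX : MemLp X 2 μ) (hX' : MemLp X' 2 μ)
    (h : crossMoment μ X X' = 0) :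
    crossMoment μ (X + X') (X + X') = crossMoment μ X X + crossMoment μ X' X' := by
  rw [crossMoment_add_self hX hX', h, Matrix.transpose_zero, add_zero, zero_add]

theorem trace_crossMoment_self (hX : MemLp X 2 μ) :
    (crossMoment μ X X).trace = ∫ ω, ‖X ω‖ ^ 2 ∂μ := by
  simp only [Matrix.trace, Matrix.diag_apply, crossMoment_apply, EuclideanSpace.real_norm_sq_eq]
  simp only [sq]
  exact (integral_finsetSum _ fun i _ => integrable_apply_mul_apply hX hX i i).symm

theorem lintegral_norm_sq (hX : MemLp X 2 μ) :
    ∫⁻ ω, ENNReal.ofReal (‖X ω‖ ^ 2) ∂μ = ENNReal.ofReal (crossMoment μ X X).trace := by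
  rw [trace_crossMoment_self hX, ofReal_integral_eq_lintegral_ofReal]
  · exact (memLp_two_iff_integrable_sq_norm hX.1).1 hX
  · exact .of_forall fun _ => by positivity

theorem lintegral_norm_add_sq (hX : MemLp X 2 μ) (hX' : MemLp X' 2 μ)
    (h : (crossMoment μ X X').trace = 0) :
    ∫⁻ ω, ENNReal.ofReal (‖(X + X') ω‖ ^ 2) ∂μ
      = ∫⁻ ω, ENNReal.ofReal (‖X ω‖ ^ 2) ∂μ + ∫⁻ ω, ENNReal.ofReal (‖X' ω‖ ^ 2) ∂μ := by
  rw [lintegral_norm_sq (hX.add hX'), lintegral_norm_sq hX, lintegral_norm_sq hX',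
    crossMoment_add_self hX hX', ← ENNReal.ofReal_add]
  · rw [Matrix.trace_add, Matrix.trace_add, Matrix.trace_add, Matrix.trace_transpose, h, add_zero,
      zero_add]
  · exact (Matrix.nonneg_iff_posSemidef.1 (crossMoment_self_nonneg hX)).trace_nonneg
  · exact (Matrix.nonneg_iff_posSemidef.1 (crossMoment_self_nonneg hX')).trace_nonneg

theorem memLp_two_of_lintegral_norm_sq_ne_top {E : Type*} [NormedAddCommGroup E] {X : Ω → E}
    (hX : AEStronglyMeasurable X μ) (h : ∫⁻ ω, ENNReal.ofReal (‖X ω‖ ^ 2) ∂μ ≠ ∞) :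
    MemLp X 2 μ := by
  refine (memLp_two_iff_integrable_sq_norm hX).2 ⟨hX.norm.pow 2, ?_⟩
  rw [hasFiniteIntegral_iff_ofReal (.of_forall fun _ => by positivity)]
  exact h.lt_top

theorem ae_eq_zero_of_lintegral_norm_sq_eq_zero {E : Type*} [NormedAddCommGroup E] {X : Ω → E}
    (hX : AEStronglyMeasurable X μ) (h : ∫⁻ ω, ENNReal.ofReal (‖X ω‖ ^ 2) ∂μ = 0) :
    X =ᵐ[μ] 0 := by
  have hae := (lintegral_eq_zero_iff' (hX.norm.pow 2).aemeasurable.ennreal_ofReal).1 h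
  filter_upwards [hae] with ω hω
  simpa [sq_nonpos_iff] using hω

end CrossMoment

section ConditionalExpectation

variable {Ω : Type*} {m' mΩ : MeasurableSpace Ω} {μ : Measure Ω} [IsFiniteMeasure μ]
  {ι κ : Type*} [Fintype ι] [Fintype κ] {X : Ω → EuclideanSpace ℝ ι}

theorem crossMoment_condExp {Y : Ω → EuclideanSpace ℝ κ} (hm : m' ≤ mΩ) (hX : MemLp X 2 μ)
    (hY : MemLp Y 2 μ) (hYm : StronglyMeasurable[m'] Y) :
    crossMoment μ (μ[X | m']) Y = crossMoment μ X Y := by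
  ext i j
  have hproj := (EuclideanSpace.proj i : EuclideanSpace ℝ ι →L[ℝ] ℝ).comp_condExp_comm
    (m := m') (hX.integrable one_le_two)
  have hYj : StronglyMeasurable[m'] fun ω => Y ω j :=
    (EuclideanSpace.proj j : EuclideanSpace ℝ κ →L[ℝ] ℝ).continuous.comp_stronglyMeasurable hYm
  have hpull := condExp_mul_of_stronglyMeasurable_right (μ := μ) (f := fun ω => X ω i) hYj
    (integrable_apply_mul_apply hX hY i j) ((hX.eval_piLp i).integrable one_le_two)
  calc ∫ ω, (μ[X | m']) ω i * Y ω j ∂μ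
      = ∫ ω, (μ[(fun ω => X ω i) * (fun ω => Y ω j) | m']) ω ∂μ := by
        refine integral_congr_ae ?_
        filter_upwards [hproj, hpull] with ω hprojω hpullω
        rw [hpullω, Pi.mul_apply]
        exact congrArg (· * Y ω j) hprojω
    _ = crossMoment μ X Y i j := integral_condExp hm

theorem crossMoment_condExp_right (hm : m' ≤ mΩ) (hX : MemLp X 2 μ) :
    crossMoment μ X (μ[X | m']) = crossMoment μ (μ[X | m']) (μ[X | m']) :=
  (crossMoment_condExp hm hX (hX.condExp one_le_two) stronglyMeasurable_condExp).symm

theorem crossMoment_condExp_le_self (hm : m' ≤ mΩ) (hX : MemLp X 2 μ) :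
    crossMoment μ (μ[X | m']) (μ[X | m']) ≤ crossMoment μ X X := by
  have hX' : MemLp (μ[X | m']) 2 μ := hX.condExp one_le_two
  have herror : crossMoment μ (X - μ[X | m']) (μ[X | m']) = 0 := by
    rw [crossMoment_sub_left hX hX' hX', crossMoment_condExp_right hm hX, sub_self]
  have := crossMoment_add_self_of_eq_zero (hX.sub hX') hX' herror
  rw [sub_add_cancel] at this
  exact this ▸ le_add_of_nonneg_left (crossMoment_self_nonneg (hX.sub hX'))

theorem crossMoment_condExp_mono {m₁ m₂ : MeasurableSpace Ω} (h : m₁ ≤ m₂) (hm : m₂ ≤ mΩ)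
    (hX : MemLp X 2 μ) :
    crossMoment μ (μ[X | m₁]) (μ[X | m₁]) ≤ crossMoment μ (μ[X | m₂]) (μ[X | m₂]) := by
  have htower := condExp_condExp_of_le (f := X) h hm (μ := μ)
  rw [← crossMoment_congr htower htower]
  exact crossMoment_condExp_le_self (h.trans hm) (hX.condExp one_le_two)

end ConditionalExpectation

section QuadraticCost

theorem trace_mul_mul_transpose {ι τ : Type*} [Fintype ι] [Fintype τ]
    (M N : Matrix τ ι ℝ) (T : Matrix ι ι ℝ) :
    (M * T * Nᵀ).trace = (Nᵀ * M * T).trace := by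
  rw [Matrix.trace_mul_comm, Matrix.mul_assoc]

variable {Ω : Type*} {m' mΩ : MeasurableSpace Ω} {μ : Measure Ω} {ι κ τ : Type*}
  [Fintype ι] [Fintype κ] [Fintype τ] [DecidableEq ι] [DecidableEq κ]
  {Q : Matrix τ ι ℝ} {R : Matrix τ κ ℝ}
  {X : Ω → EuclideanSpace ℝ ι} {u u' : Ω → EuclideanSpace ℝ κ}

/-- The expected quadratic cost `E[‖Q X + R u‖²]` of a random action `u` in a random state `X`,
possibly infinite. -/
noncomputable def stageCost (μ : Measure Ω) (Q : Matrix τ ι ℝ) (R : Matrix τ κ ℝ)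
    (X : Ω → EuclideanSpace ℝ ι) (u : Ω → EuclideanSpace ℝ κ) : ℝ≥0∞ :=
  ∫⁻ ω, ENNReal.ofReal (‖(Q.toEuclideanLin ∘ X + R.toEuclideanLin ∘ u) ω‖ ^ 2) ∂μ

theorem stageCost_congr (h : u =ᵐ[μ] u') : stageCost μ Q R X u = stageCost μ Q R X u' := by
  refine lintegral_congr_ae ?_
  filter_upwards [h] with ω hω
  simp only [Pi.add_apply, Function.comp_apply, hω]

theorem memLp_residual (hX : MemLp X 2 μ) (hu : MemLp u 2 μ) :
    MemLp (Q.toEuclideanLin ∘ X + R.toEuclideanLin ∘ u) 2 μ :=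
  (memLp_toEuclideanLin_comp hX Q).add (memLp_toEuclideanLin_comp hu R)

theorem stageCost_lt_top (hX : MemLp X 2 μ) (hu : MemLp u 2 μ) : stageCost μ Q R X u < ∞ := by
  rw [stageCost, lintegral_norm_sq (memLp_residual hX hu)]
  exact ENNReal.ofReal_lt_top

theorem leftInverse_toEuclideanLin [DecidableEq τ] (hR : IsUnit (Rᵀ * R)) :
    Function.LeftInverse ((Rᵀ * R)⁻¹ * Rᵀ).toEuclideanLin R.toEuclideanLin := fun y => by
  rw [← LinearMap.comp_apply, ← Matrix.toLpLin_mul_same, Matrix.mul_assoc,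
    Matrix.nonsing_inv_mul _ ((Matrix.isUnit_iff_isUnit_det _).1 hR), Matrix.toLpLin_one,
    LinearMap.id_apply]

theorem memLp_of_stageCost_ne_top (hR : IsUnit (Rᵀ * R)) (hX : MemLp X 2 μ)
    (hu : AEStronglyMeasurable u μ) (h : stageCost μ Q R X u ≠ ∞) : MemLp u 2 μ := by
  classical
  have hQX := memLp_toEuclideanLin_comp hX Q
  have hRu : AEStronglyMeasurable (R.toEuclideanLin ∘ u) μ :=
    (LinearMap.continuous_of_finiteDimensional _).comp_aestronglyMeasurable hu
  have hres := memLp_two_of_lintegral_norm_sq_ne_top (hQX.1.add hRu) h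
  have hRu' : MemLp (R.toEuclideanLin ∘ u) 2 μ := by simpa using hres.sub hQX
  convert memLp_toEuclideanLin_comp hRu' ((Rᵀ * R)⁻¹ * Rᵀ)
  exact (funext fun ω => leftInverse_toEuclideanLin hR (u ω)).symm

/-- The optimal action `-(Rᵀ R)⁻¹ Rᵀ Q E[X | m']` for the cost `E[‖Q X + R u‖²]` of a player whose
information is `m'`. -/
noncomputable def optimalAction (μ : Measure Ω) (m' : MeasurableSpace Ω) (Q : Matrix τ ι ℝ)
    (R : Matrix τ κ ℝ) (X : Ω → EuclideanSpace ℝ ι) : Ω → EuclideanSpace ℝ κ :=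
  (-((Rᵀ * R)⁻¹ * Rᵀ * Q)).toEuclideanLin ∘ μ[X | m']

theorem stronglyMeasurable_optimalAction : StronglyMeasurable[m'] (optimalAction μ m' Q R X) :=
  (LinearMap.continuous_of_finiteDimensional _).comp_stronglyMeasurable stronglyMeasurable_condExp

theorem memLp_optimalAction (hX : MemLp X 2 μ) : MemLp (optimalAction μ m' Q R X) 2 μ :=
  memLp_toEuclideanLin_comp (hX.condExp one_le_two) _

variable [IsFiniteMeasure μ]

/- The normal equation `Rᵀ (Q X̂ + R u) = 0` of the optimal action `u`, where `X̂ = E[X | m']`. -/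
theorem trace_crossMoment_residual_optimalAction (hm : m' ≤ mΩ) (hR : IsUnit (Rᵀ * R))
    (hX : MemLp X 2 μ) (hu : MemLp u 2 μ) (hum : StronglyMeasurable[m'] u) :
    (crossMoment μ (Q.toEuclideanLin ∘ X + R.toEuclideanLin ∘ optimalAction μ m' Q R X)
      (R.toEuclideanLin ∘ u)).trace = 0 := by
  have hv : MemLp (optimalAction μ m' Q R X) 2 μ := memLp_optimalAction hX
  have hcross : crossMoment μ (optimalAction μ m' Q R X) u
      = -((Rᵀ * R)⁻¹ * Rᵀ * Q) * crossMoment μ X u := by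
    rw [optimalAction, crossMoment_toEuclideanLin_left (hX.condExp one_le_two) hu,
      crossMoment_condExp hm hX hu hum]
  have hnormal : Rᵀ * (Q * crossMoment μ X u
      + R * (-((Rᵀ * R)⁻¹ * Rᵀ * Q) * crossMoment μ X u)) = 0 := by
    have hinv : Rᵀ * R * (Rᵀ * R)⁻¹ = 1 :=
      Matrix.mul_nonsing_inv _ ((Matrix.isUnit_iff_isUnit_det _).1 hR)
    calc _ = (1 - Rᵀ * R * (Rᵀ * R)⁻¹) * (Rᵀ * (Q * crossMoment μ X u)) := by
          simp only [Matrix.neg_mul, Matrix.mul_neg, ← sub_eq_add_neg, Matrix.mul_sub,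
            Matrix.sub_mul, Matrix.one_mul, Matrix.mul_assoc]
      _ = 0 := by rw [hinv, sub_self, Matrix.zero_mul]
  rw [crossMoment_toEuclideanLin_right (memLp_residual hX hv) hu,
    crossMoment_add_left (memLp_toEuclideanLin_comp hX Q) (memLp_toEuclideanLin_comp hv R) hu,
    crossMoment_toEuclideanLin_left hX hu, crossMoment_toEuclideanLin_left hv hu, hcross,
    Matrix.trace_mul_comm, hnormal, Matrix.trace_zero]

theorem stageCost_eq_add (hm : m' ≤ mΩ) (hR : IsUnit (Rᵀ * R)) (hX : MemLp X 2 μ)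
    (hu : MemLp u 2 μ) (hum : StronglyMeasurable[m'] u) :
    stageCost μ Q R X u = stageCost μ Q R X (optimalAction μ m' Q R X)
      + ∫⁻ ω, ENNReal.ofReal
        (‖(R.toEuclideanLin ∘ (u - optimalAction μ m' Q R X)) ω‖ ^ 2) ∂μ := by
  have hv : MemLp (optimalAction μ m' Q R X) 2 μ := memLp_optimalAction hX
  have hsplit : Q.toEuclideanLin ∘ X + R.toEuclideanLin ∘ u
      = (Q.toEuclideanLin ∘ X + R.toEuclideanLin ∘ optimalAction μ m' Q R X)
        + R.toEuclideanLin ∘ (u - optimalAction μ m' Q R X) := by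
    funext ω
    simp only [Pi.add_apply, Pi.sub_apply, Function.comp_apply, map_sub]
    abel
  rw [stageCost, stageCost, hsplit, lintegral_norm_add_sq (memLp_residual hX hv)
    (memLp_toEuclideanLin_comp (hu.sub hv) R) (trace_crossMoment_residual_optimalAction hm hR hX
      (hu.sub hv) (hum.sub stronglyMeasurable_optimalAction))]

theorem stageCost_optimalAction_le (hm : m' ≤ mΩ) (hR : IsUnit (Rᵀ * R)) (hX : MemLp X 2 μ)
    (hum : StronglyMeasurable[m'] u) :
    stageCost μ Q R X (optimalAction μ m' Q R X) ≤ stageCost μ Q R X u := by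
  by_cases htop : stageCost μ Q R X u = ∞
  · exact htop ▸ le_top
  · have hu := memLp_of_stageCost_ne_top hR hX (hum.mono hm).aestronglyMeasurable htop
    exact le_self_add.trans_eq (stageCost_eq_add hm hR hX hu hum).symm

theorem ae_eq_optimalAction_of_stageCost_le (hm : m' ≤ mΩ) (hR : IsUnit (Rᵀ * R))
    (hX : MemLp X 2 μ) (hum : StronglyMeasurable[m'] u)
    (h : stageCost μ Q R X u ≤ stageCost μ Q R X (optimalAction μ m' Q R X)) :
    u =ᵐ[μ] optimalAction μ m' Q R X := by
  classical
  have hv : MemLp (optimalAction μ m' Q R X) 2 μ := memLp_optimalAction hX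
  have hfin := stageCost_lt_top (Q := Q) (R := R) hX hv
  have hu := memLp_of_stageCost_ne_top hR hX (hum.mono hm).aestronglyMeasurable
    (h.trans_lt hfin).ne
  have hzero := (ENNReal.add_le_add_iff_left hfin.ne).1
    (((stageCost_eq_add hm hR hX hu hum).symm.trans_le h).trans_eq (add_zero _).symm)
  have hRd := ae_eq_zero_of_lintegral_norm_sq_eq_zero
    (memLp_toEuclideanLin_comp (hu.sub hv) R).1 (nonpos_iff_eq_zero.1 hzero)
  filter_upwards [hRd] with ω hω
  rw [← sub_eq_zero, ← leftInverse_toEuclideanLin hR (u ω - optimalAction μ m' Q R X ω)]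
  simpa using congrArg ((Rᵀ * R)⁻¹ * Rᵀ).toEuclideanLin hω

theorem stageCost_optimalAction (hm : m' ≤ mΩ) (hX : MemLp X 2 μ) (Q' : Matrix τ ι ℝ)
    (R' : Matrix τ κ ℝ) {Λ : Matrix τ ι ℝ} (hΛ : Λ = R' * (Rᵀ * R)⁻¹ * Rᵀ * Q) :
    stageCost μ Q' R' X (optimalAction μ m' Q R X)
      = ENNReal.ofReal ((Q'ᵀ * Q' * crossMoment μ X X).trace
        + ((Λᵀ * Λ - Λᵀ * Q' - Q'ᵀ * Λ) * crossMoment μ (μ[X | m']) (μ[X | m'])).trace) := by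
  have hX' : MemLp (μ[X | m']) 2 μ := hX.condExp one_le_two
  have hresidual : Q'.toEuclideanLin ∘ X + R'.toEuclideanLin ∘ optimalAction μ m' Q R X
      = Q'.toEuclideanLin ∘ X + (-Λ).toEuclideanLin ∘ μ[X | m'] := by
    rw [optimalAction, ← Function.comp_assoc, ← LinearMap.coe_comp, ← Matrix.toLpLin_mul_same, hΛ]
    simp only [Matrix.mul_neg, Matrix.mul_assoc]
  rw [stageCost, hresidual, lintegral_norm_sq (memLp_residual hX hX'),
    crossMoment_add_self (memLp_toEuclideanLin_comp hX Q') (memLp_toEuclideanLin_comp hX' (-Λ)),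
    crossMoment_toEuclideanLin_self hX, crossMoment_toEuclideanLin_self hX',
    crossMoment_toEuclideanLin_right (memLp_toEuclideanLin_comp hX Q') hX',
    crossMoment_toEuclideanLin_left hX hX', crossMoment_condExp_right hm hX]
  congr 1
  simp only [Matrix.transpose_mul, Matrix.transpose_transpose, crossMoment_transpose,
    ← Matrix.mul_assoc, Matrix.transpose_neg, Matrix.neg_mul, Matrix.mul_neg, Matrix.sub_mul,
    Matrix.trace_add, Matrix.trace_sub, Matrix.trace_neg, trace_mul_mul_transpose, neg_neg]
  ring

end QuadraticCost

section Gaussian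

variable {Ω : Type*} {mΩ : MeasurableSpace Ω} {μ : Measure Ω} {ι κ τ : Type*}
  [Fintype ι] [Fintype κ] {X : Ω → EuclideanSpace ℝ ι} {Y : Ω → EuclideanSpace ℝ κ}

theorem crossMoment_apply_eq_covariance [IsProbabilityMeasure μ] (hX : MemLp X 2 μ)
    (hY : MemLp Y 2 μ) (h0 : ∫ ω, X ω ∂μ = 0) (i : ι) (j : κ) :
    crossMoment μ X Y i j = cov[fun ω => X ω i, fun ω => Y ω j; μ] := by
  have hmean : ∫ ω, X ω i ∂μ = 0 := by
    rw [← eval_integral_piLp fun i => (hX.integrable one_le_two).eval_piLp i, h0, PiLp.zero_apply]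
  rw [covariance_eq_sub (hX.eval_piLp i) (hY.eval_piLp j), hmean, zero_mul, sub_zero]
  rfl

theorem crossMoment_of_hasLaw [DecidableEq ι] {C : Matrix ι ι ℝ} (hC : C.PosSemidef)
    (hX : HasLaw X (multivariateGaussian 0 C) μ) : crossMoment μ X X = C := by
  have hlaw : HasGaussianLaw X μ := hX.hasGaussianLaw
  have := hlaw.isProbabilityMeasure
  ext i j
  rw [crossMoment_apply_eq_covariance hlaw.memLp_two hlaw.memLp_two
      (hX.integral_eq.trans integral_id_multivariateGaussian),
    ← covariance_eval_multivariateGaussian (μ := 0) hC]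
  exact hX.covariance_fun_comp (f := fun v => v i) (g := fun v => v j) (by fun_prop) (by fun_prop)

theorem crossMoment_of_indepFun [IsProbabilityMeasure μ] (h : IndepFun X Y μ) (hX : MemLp X 2 μ)
    (hY : MemLp Y 2 μ) (h0 : ∫ ω, X ω ∂μ = 0) : crossMoment μ X Y = 0 := by
  ext i j
  rw [crossMoment_apply_eq_covariance hX hY h0, Matrix.zero_apply]
  have hij : IndepFun (fun ω => X ω i) (fun ω => Y ω j) μ :=
    h.comp (φ := fun v : EuclideanSpace ℝ ι => v i) (ψ := fun v : EuclideanSpace ℝ κ => v j)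
      (by fun_prop) (by fun_prop)
  exact hij.covariance_eq_zero (hX.eval_piLp i) (hY.eval_piLp j)

variable {E F F' : Type*} [NormedAddCommGroup E] [NormedSpace ℝ E] [NormedAddCommGroup F]
  [NormedSpace ℝ F] [NormedAddCommGroup F'] [NormedSpace ℝ F']

/-- `X` is a continuous linear function of `Z`. All the random vectors of a linear Gaussian system
are of this form, with `Z` the vector of its independent sources, and so are jointly Gaussian. -/
def IsLinearImage (Z : Ω → E) (X : Ω → F) : Prop :=
  ∃ T : E →L[ℝ] F, X = T ∘ Z

namespace IsLinearImage

variable {Z : Ω → E} {X X' : Ω → F} {X'' : Ω → F'}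

theorem zero : IsLinearImage Z (0 : Ω → F) := ⟨0, rfl⟩

theorem add (hX : IsLinearImage Z X) (hX' : IsLinearImage Z X') : IsLinearImage Z (X + X') := by
  obtain ⟨T, rfl⟩ := hX
  obtain ⟨T', rfl⟩ := hX'
  exact ⟨T + T', rfl⟩

theorem sub (hX : IsLinearImage Z X) (hX' : IsLinearImage Z X') : IsLinearImage Z (X - X') := by
  obtain ⟨T, rfl⟩ := hX
  obtain ⟨T', rfl⟩ := hX'
  exact ⟨T - T', rfl⟩

theorem map (hX : IsLinearImage Z X) (U : F →L[ℝ] F') : IsLinearImage Z (U ∘ X) := by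
  obtain ⟨T, rfl⟩ := hX
  exact ⟨U.comp T, rfl⟩

theorem prodMk (hX : IsLinearImage Z X) (hX'' : IsLinearImage Z X'') :
    IsLinearImage Z fun ω => (X ω, X'' ω) := by
  obtain ⟨T, rfl⟩ := hX
  obtain ⟨T', rfl⟩ := hX''
  exact ⟨T.prod T', rfl⟩

theorem pi {Y : τ → Ω → F} [Fintype τ] (hY : ∀ j, IsLinearImage Z (Y j)) :
    IsLinearImage Z fun ω j => Y j ω := by
  choose T hT using hY
  obtain rfl : Y = fun j => T j ∘ Z := funext hT
  exact ⟨.pi T, rfl⟩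

theorem memLp (hX : IsLinearImage Z X) (hZ : MemLp Z 2 μ) : MemLp X 2 μ := by
  obtain ⟨T, rfl⟩ := hX
  exact T.comp_memLp' hZ

theorem integral_eq_zero [CompleteSpace E] [CompleteSpace F] (hX : IsLinearImage Z X)
    (hZ : Integrable Z μ) (h0 : ∫ ω, Z ω ∂μ = 0) : ∫ ω, X ω ∂μ = 0 := by
  obtain ⟨T, rfl⟩ := hX
  exact (T.integral_comp_comm hZ).trans (by rw [h0, map_zero])

variable [MeasurableSpace E] [BorelSpace E]

theorem hasGaussianLaw [MeasurableSpace F] [BorelSpace F] (hX : IsLinearImage Z X)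
    (hZ : HasGaussianLaw Z μ) : HasGaussianLaw X μ := by
  obtain ⟨T, rfl⟩ := hX
  exact hZ.map T

theorem indepFun [CompleteSpace E] [SecondCountableTopology E] [Finite τ]
    {X : Ω → EuclideanSpace ℝ ι} {Y : τ → Ω → EuclideanSpace ℝ κ} (hX : IsLinearImage Z X)
    (hY : ∀ j, IsLinearImage Z (Y j)) (hZ : HasGaussianLaw Z μ) (h0 : ∫ ω, Z ω ∂μ = 0)
    (hXY : ∀ j, crossMoment μ X (Y j) = 0) : IndepFun X (fun ω j => Y j ω) μ := by
  have := Fintype.ofFinite τ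
  have := hZ.isProbabilityMeasure
  have hlaw : HasGaussianLaw (fun ω => (fun i => X ω i, fun l : τ × κ => Y l.1 ω l.2)) μ :=
    ((pi fun i => hX.map (EuclideanSpace.proj i : _ →L[ℝ] ℝ)).prodMk
      (pi fun l : τ × κ => (hY l.1).map (EuclideanSpace.proj l.2 : _ →L[ℝ] ℝ))).hasGaussianLaw hZ
  have hcoord := hlaw.indepFun_of_covariance_eval (X := fun i ω => X ω i) fun i l => by
    rw [← crossMoment_apply_eq_covariance (hX.memLp hZ.memLp_two) ((hY l.1).memLp hZ.memLp_two)
      (hX.integral_eq_zero hZ.integrable h0), hXY, Matrix.zero_apply]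
  exact hcoord.comp (φ := WithLp.toLp 2) (ψ := fun f j => WithLp.toLp 2 fun i => f (j, i))
    (by fun_prop) (by fun_prop)

end IsLinearImage

end Gaussian

section StateProcess

variable {m p t q : ℕ} {Ω : Type*} {G : Game m p t q} {x w : ℕ → Ω → Vec p}

/-- The joint vector of the independent sources of randomness of the state process: the initial
state and the noises. -/
def driver (G : Game m p t q) (x w : ℕ → Ω → Vec p) (ω : Ω) (i : Fin (G.n + 1)) : Vec p :=
  (Fin.cons (x 0) (fun k : Fin G.n => w k) : Fin (G.n + 1) → Ω → Vec p) i ω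

theorem isLinearImage_driver_apply (i : Fin (G.n + 1)) :
    IsLinearImage (driver G x w) fun ω => driver G x w ω i :=
  ⟨.proj i, rfl⟩

theorem isLinearImage_noise {k : ℕ} (hk : k < G.n) : IsLinearImage (driver G x w) (w k) :=
  isLinearImage_driver_apply (Fin.succ ⟨k, hk⟩)

variable [MeasurableSpace Ω] {μ : Measure Ω}

namespace IsStateProcess

theorem hasGaussianLaw_driver (hx : IsStateProcess G μ x w) :
    HasGaussianLaw (driver G x w) μ := by
  refine iIndepFun.hasGaussianLaw (fun i => ?_) hx.indep
  induction i using Fin.cases with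
  | zero => exact hx.law_init.hasGaussianLaw
  | succ k => exact (hx.law_noise k k.2).hasGaussianLaw

theorem isProbabilityMeasure (hx : IsStateProcess G μ x w) : IsProbabilityMeasure μ :=
  hx.hasGaussianLaw_driver.isProbabilityMeasure

theorem integral_driver (hx : IsStateProcess G μ x w) : ∫ ω, driver G x w ω ∂μ = 0 := by
  funext i
  rw [eval_integral fun j => hx.hasGaussianLaw_driver.integrable.eval j, Pi.zero_apply]
  induction i using Fin.cases with
  | zero => exact hx.law_init.integral_eq.trans integral_id_multivariateGaussian
  | succ k => exact (hx.law_noise k k.2).integral_eq.trans integral_id_multivariateGaussian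

theorem memLp_of_isLinearImage (hx : IsStateProcess G μ x w) {F : Type*} [NormedAddCommGroup F]
    [NormedSpace ℝ F] {X : Ω → F} (hX : IsLinearImage (driver G x w) X) : MemLp X 2 μ :=
  hX.memLp hx.hasGaussianLaw_driver.memLp_two

theorem integral_of_isLinearImage (hx : IsStateProcess G μ x w) {F : Type*}
    [NormedAddCommGroup F] [NormedSpace ℝ F] [CompleteSpace F] {X : Ω → F}
    (hX : IsLinearImage (driver G x w) X) : ∫ ω, X ω ∂μ = 0 :=
  hX.integral_eq_zero hx.hasGaussianLaw_driver.integrable hx.integral_driver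

theorem state_succ (hx : IsStateProcess G μ x w) {k : ℕ} (hk : k < G.n) :
    x (k + 1) = G.A.toEuclideanLin ∘ x k + w k :=
  funext (hx.dynamics k hk)

theorem isLinearImage_state (hx : IsStateProcess G μ x w) {k : ℕ} (hk : k ≤ G.n) :
    IsLinearImage (driver G x w) (x k) := by
  induction k with
  | zero => exact isLinearImage_driver_apply 0
  | succ k ih =>
    rw [hx.state_succ hk]
    exact ((ih (by lia)).map G.A.toEuclideanLin.toContinuousLinearMap).add
      (isLinearImage_noise hk)

theorem memLp_state (hx : IsStateProcess G μ x w) {k : ℕ} (hk : k ≤ G.n) : MemLp (x k) 2 μ :=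
  hx.memLp_of_isLinearImage (hx.isLinearImage_state hk)

theorem memLp_noise (hx : IsStateProcess G μ x w) {k : ℕ} (hk : k < G.n) : MemLp (w k) 2 μ :=
  hx.memLp_of_isLinearImage (isLinearImage_noise hk)

theorem measurable_state (hx : IsStateProcess G μ x w) {k : ℕ} (hk : k ≤ G.n) :
    Measurable (x k) := by
  induction k with
  | zero => exact hx.measurable_init
  | succ k ih =>
    rw [hx.state_succ hk]
    exact ((LinearMap.continuous_of_finiteDimensional _).measurable.comp (ih (by lia))).add
      (hx.measurable_noise k hk)

theorem crossMoment_noise_driver (hx : IsStateProcess G μ x w) {j : ℕ} (hj : j < G.n)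
    {i : Fin (G.n + 1)} (hi : i ≠ Fin.succ ⟨j, hj⟩) :
    crossMoment μ (w j) (fun ω => driver G x w ω i) = 0 := by
  have := hx.isProbabilityMeasure
  exact crossMoment_of_indepFun (hx.indep.indepFun hi.symm) (hx.memLp_noise hj)
    (hx.memLp_of_isLinearImage (isLinearImage_driver_apply i))
    (hx.integral_of_isLinearImage (isLinearImage_noise hj))

theorem crossMoment_noise_state (hx : IsStateProcess G μ x w) {j k : ℕ} (hkj : k ≤ j)
    (hj : j < G.n) : crossMoment μ (w j) (x k) = 0 := by
  induction k with
  | zero => exact hx.crossMoment_noise_driver hj (i := 0) (Fin.succ_ne_zero _).symm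
  | succ k ih =>
    have hxk : MemLp (x k) 2 μ := hx.memLp_state (by lia)
    have hnoise : crossMoment μ (w j) (w k) = 0 :=
      hx.crossMoment_noise_driver hj (i := Fin.succ ⟨k, by lia⟩) (by simp; lia)
    rw [hx.state_succ (by lia), crossMoment_add_right (hx.memLp_noise hj)
        (memLp_toEuclideanLin_comp hxk _) (hx.memLp_noise (by lia)),
      crossMoment_toEuclideanLin_right (hx.memLp_noise hj) hxk, ih (by lia), hnoise,
      Matrix.zero_mul, add_zero]

theorem crossMoment_state (hx : IsStateProcess G μ x w) {k : ℕ} (hk : k ≤ G.n) :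
    crossMoment μ (x k) (x k) = G.stateCov k := by
  induction k with
  | zero => exact crossMoment_of_hasLaw G.covInit_psd hx.law_init
  | succ k ih =>
    have hxk : MemLp (x k) 2 μ := hx.memLp_state (by lia)
    have huncorr : crossMoment μ (G.A.toEuclideanLin ∘ x k) (w k) = 0 := by
      rw [crossMoment_toEuclideanLin_left hxk (hx.memLp_noise hk), ← crossMoment_transpose,
        hx.crossMoment_noise_state le_rfl hk, Matrix.transpose_zero, Matrix.mul_zero]
    rw [hx.state_succ hk, crossMoment_add_self_of_eq_zero (memLp_toEuclideanLin_comp hxk _)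
        (hx.memLp_noise hk) huncorr, crossMoment_toEuclideanLin_self hxk, ih (by lia),
      crossMoment_of_hasLaw G.covNoise_psd (hx.law_noise k hk), Game.stateCov]

end IsStateProcess

end StateProcess

section LinearFilter

variable {m p t q : ℕ} {Ω : Type*} {G : Game m p t q} {x w : ℕ → Ω → Vec p}

/-- The linear filter with the gains `H 1, H 2, …`, started from the estimate `0` of `x 0` and
updated by `f_{k+1} = A f_k + H_{k+1} (x_{k+1} - A f_k)`. It sees `x_{k+1}` only through
`H_{k+1}`. -/
noncomputable def linearFilter (A : Mat p) (H : ℕ → Mat p) (x : ℕ → Ω → Vec p) : ℕ → Ω → Vec p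
  | 0 => 0
  | k + 1 => A.toEuclideanLin ∘ linearFilter A H x k
    + (H (k + 1)).toEuclideanLin ∘ (x (k + 1) - A.toEuclideanLin ∘ linearFilter A H x k)

/-- The innovation `x_{k+1} - A f_k` of the linear filter at stage `k + 1`. -/
noncomputable def innovation (A : Mat p) (H : ℕ → Mat p) (x : ℕ → Ω → Vec p) (k : ℕ) : Ω → Vec p :=
  x (k + 1) - A.toEuclideanLin ∘ linearFilter A H x k

/-- The estimation error `x_k - f_k` of the linear filter. -/
noncomputable def filterError (A : Mat p) (H : ℕ → Mat p) (x : ℕ → Ω → Vec p) (k : ℕ) :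
    Ω → Vec p :=
  x k - linearFilter A H x k

variable {A : Mat p} {H : ℕ → Mat p}

theorem linearFilter_succ (k : ℕ) : linearFilter A H x (k + 1)
    = A.toEuclideanLin ∘ linearFilter A H x k
      + (H (k + 1)).toEuclideanLin ∘ innovation A H x k := rfl

theorem filterError_succ (k : ℕ) :
    filterError A H x (k + 1) = (1 - H (k + 1)).toEuclideanLin ∘ innovation A H x k := by
  funext ω
  simp only [filterError, linearFilter_succ, innovation, Pi.sub_apply, Pi.add_apply,
    Function.comp_apply, map_sub, LinearMap.sub_apply, Matrix.toLpLin_one, LinearMap.id_apply]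
  abel

/-- The gains `H` realize the covariances `S`: the linear filter with these gains has the
covariances `S 0, …, S n` and an error uncorrelated with itself. Such a gain projects, in the
sense `H D Hᵀ = D Hᵀ`, where `D` is the covariance of the innovation. -/
structure IsFilterGain (G : Game m p t q) (S H : ℕ → Mat p) : Prop where
  zero : S 0 = 0
  recursion : ∀ k < G.n,
    S (k + 1) = G.A * S k * G.Aᵀ + H (k + 1) * G.innovCov S k * (H (k + 1))ᵀ
  proj : ∀ k < G.n, H (k + 1) * G.innovCov S k * (H (k + 1))ᵀ = G.innovCov S k * (H (k + 1))ᵀ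

variable [MeasurableSpace Ω] {μ : Measure Ω} {S : ℕ → Mat p}

namespace IsStateProcess

theorem isLinearImage_linearFilter (hx : IsStateProcess G μ x w) {k : ℕ} (hk : k ≤ G.n) :
    IsLinearImage (driver G x w) (linearFilter A H x k) := by
  induction k with
  | zero => exact IsLinearImage.zero
  | succ k ih =>
    have hpred := (ih (by lia)).map A.toEuclideanLin.toContinuousLinearMap
    exact hpred.add (((hx.isLinearImage_state hk).sub hpred).map
      (H (k + 1)).toEuclideanLin.toContinuousLinearMap)

theorem isLinearImage_filterError (hx : IsStateProcess G μ x w) {k : ℕ} (hk : k ≤ G.n) :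
    IsLinearImage (driver G x w) (filterError A H x k) :=
  (hx.isLinearImage_state hk).sub (hx.isLinearImage_linearFilter hk)

theorem memLp_linearFilter (hx : IsStateProcess G μ x w) {k : ℕ} (hk : k ≤ G.n) :
    MemLp (linearFilter A H x k) 2 μ :=
  hx.memLp_of_isLinearImage (hx.isLinearImage_linearFilter hk)

theorem memLp_filterError (hx : IsStateProcess G μ x w) {k : ℕ} (hk : k ≤ G.n) :
    MemLp (filterError A H x k) 2 μ :=
  hx.memLp_of_isLinearImage (hx.isLinearImage_filterError hk)

theorem memLp_innovation (hx : IsStateProcess G μ x w) {k : ℕ} (hk : k < G.n) :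
    MemLp (innovation A H x k) 2 μ :=
  (hx.memLp_state hk).sub (memLp_toEuclideanLin_comp (hx.memLp_linearFilter hk.le) A)

theorem innovation_eq (hx : IsStateProcess G μ x w) {k : ℕ} (hk : k < G.n) :
    innovation G.A H x k = G.A.toEuclideanLin ∘ filterError G.A H x k + w k := by
  funext ω
  simp only [innovation, filterError, hx.state_succ hk, Pi.sub_apply, Pi.add_apply,
    Function.comp_apply, map_sub]
  abel

theorem crossMoment_innovation (hx : IsStateProcess G μ x w) {k : ℕ} (hk : k < G.n) {ι : Type*}
    [Fintype ι] {Y : Ω → EuclideanSpace ℝ ι} (hY : MemLp Y 2 μ)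
    (herror : crossMoment μ (filterError G.A H x k) Y = 0) (hnoise : crossMoment μ (w k) Y = 0) :
    crossMoment μ (innovation G.A H x k) Y = 0 := by
  have he : MemLp (filterError G.A H x k) 2 μ := hx.memLp_filterError hk.le
  rw [hx.innovation_eq hk,
    crossMoment_add_left (memLp_toEuclideanLin_comp he _) (hx.memLp_noise hk) hY,
    crossMoment_toEuclideanLin_left he hY, herror, hnoise, Matrix.mul_zero, add_zero]

theorem crossMoment_noise_linearFilter (hx : IsStateProcess G μ x w) {j k : ℕ} (hkj : k ≤ j)
    (hj : j < G.n) : crossMoment μ (w j) (linearFilter A H x k) = 0 := by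
  have hw := hx.memLp_noise hj
  induction k with
  | zero => exact crossMoment_zero_right _
  | succ k ih =>
    have hf : MemLp (linearFilter A H x k) 2 μ := hx.memLp_linearFilter (by lia)
    have hAf := memLp_toEuclideanLin_comp hf A
    have hν : MemLp (innovation A H x k) 2 μ := hx.memLp_innovation (by lia)
    have hpred : crossMoment μ (w j) (A.toEuclideanLin ∘ linearFilter A H x k) = 0 := by
      rw [crossMoment_toEuclideanLin_right hw hf, ih (by lia), Matrix.zero_mul]
    rw [linearFilter_succ, crossMoment_add_right hw hAf (memLp_toEuclideanLin_comp hν _),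
      crossMoment_toEuclideanLin_right hw hν, innovation,
      crossMoment_sub_right hw (hx.memLp_state (by lia)) hAf, hpred,
      hx.crossMoment_noise_state hkj hj, sub_zero, Matrix.zero_mul, add_zero]

theorem crossMoment_innovation_linearFilter (hx : IsStateProcess G μ x w) {k : ℕ} (hk : k < G.n)
    (hef : crossMoment μ (filterError G.A H x k) (linearFilter G.A H x k) = 0) :
    crossMoment μ (innovation G.A H x k) (linearFilter G.A H x k) = 0 :=
  hx.crossMoment_innovation hk (hx.memLp_linearFilter hk.le) hef
    (hx.crossMoment_noise_linearFilter le_rfl hk)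

theorem crossMoment_prediction_innovation (hx : IsStateProcess G μ x w) {k : ℕ} (hk : k < G.n)
    (hef : crossMoment μ (filterError G.A H x k) (linearFilter G.A H x k) = 0) :
    crossMoment μ (G.A.toEuclideanLin ∘ linearFilter G.A H x k) (innovation G.A H x k) = 0 := by
  rw [crossMoment_toEuclideanLin_left (hx.memLp_linearFilter hk.le) (hx.memLp_innovation hk),
    ← crossMoment_transpose, hx.crossMoment_innovation_linearFilter hk hef, Matrix.transpose_zero,
    Matrix.mul_zero]

theorem crossMoment_innovation_self (hx : IsStateProcess G μ x w) {k : ℕ} (hk : k < G.n)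
    (hff : crossMoment μ (linearFilter G.A H x k) (linearFilter G.A H x k) = S k)
    (hef : crossMoment μ (filterError G.A H x k) (linearFilter G.A H x k) = 0) :
    crossMoment μ (innovation G.A H x k) (innovation G.A H x k) = G.innovCov S k := by
  have hf : MemLp (linearFilter G.A H x k) 2 μ := hx.memLp_linearFilter hk.le
  have hsplit := crossMoment_add_self_of_eq_zero (memLp_toEuclideanLin_comp hf G.A)
    (hx.memLp_innovation hk) (hx.crossMoment_prediction_innovation hk hef)
  rw [innovation, add_sub_cancel, hx.crossMoment_state hk, crossMoment_toEuclideanLin_self hf,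
    hff] at hsplit
  exact eq_sub_of_add_eq' hsplit.symm

theorem crossMoment_linearFilter_and_filterError (hx : IsStateProcess G μ x w)
    (hH : IsFilterGain G S H) {k : ℕ} (hk : k ≤ G.n) :
    crossMoment μ (linearFilter G.A H x k) (linearFilter G.A H x k) = S k ∧
      crossMoment μ (filterError G.A H x k) (linearFilter G.A H x k) = 0 := by
  induction k with
  | zero => exact ⟨(crossMoment_zero_left _).trans hH.zero.symm, crossMoment_zero_right _⟩
  | succ k ih =>
    obtain ⟨hff, hef⟩ := ih (by lia)
    have hf : MemLp (linearFilter G.A H x k) 2 μ := hx.memLp_linearFilter (by lia)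
    have hν : MemLp (innovation G.A H x k) 2 μ := hx.memLp_innovation hk
    have hAf := memLp_toEuclideanLin_comp hf G.A
    have hHν := memLp_toEuclideanLin_comp hν (H (k + 1))
    have hνν := hx.crossMoment_innovation_self hk hff hef
    have hfν : crossMoment μ (G.A.toEuclideanLin ∘ linearFilter G.A H x k)
        ((H (k + 1)).toEuclideanLin ∘ innovation G.A H x k) = 0 := by
      rw [crossMoment_toEuclideanLin_right hAf hν, hx.crossMoment_prediction_innovation hk hef,
        Matrix.zero_mul]
    constructor
    · rw [linearFilter_succ, crossMoment_add_self_of_eq_zero hAf hHν hfν,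
        crossMoment_toEuclideanLin_self hf, crossMoment_toEuclideanLin_self hν, hff, hνν,
        hH.recursion k hk]
    · rw [filterError_succ, crossMoment_toEuclideanLin_left hν (hx.memLp_linearFilter hk),
        linearFilter_succ, crossMoment_add_right hν hAf hHν, crossMoment_toEuclideanLin_right hν hf,
        hx.crossMoment_innovation_linearFilter hk hef, crossMoment_toEuclideanLin_right hν hν, hνν,
        Matrix.zero_mul, zero_add, Matrix.sub_mul, Matrix.one_mul, ← Matrix.mul_assoc,
        hH.proj k hk, sub_self]

theorem crossMoment_innovation_state (hx : IsStateProcess G μ x w) (hH : IsFilterGain G S H)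
    {k : ℕ} (hk : k < G.n) :
    crossMoment μ (innovation G.A H x k) (x (k + 1)) = G.innovCov S k := by
  obtain ⟨hff, hef⟩ := hx.crossMoment_linearFilter_and_filterError hH hk.le
  have hf : MemLp (linearFilter G.A H x k) 2 μ := hx.memLp_linearFilter hk.le
  have hν : MemLp (innovation G.A H x k) 2 μ := hx.memLp_innovation hk
  have hsplit := crossMoment_add_right hν (memLp_toEuclideanLin_comp hf G.A) hν
  rw [crossMoment_toEuclideanLin_right hν hf, hx.crossMoment_innovation_linearFilter hk hef,
    hx.crossMoment_innovation_self hk hff hef, Matrix.zero_mul, zero_add] at hsplit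
  rw [← hsplit, innovation, add_sub_cancel]

theorem crossMoment_filterError_signal (hx : IsStateProcess G μ x w) (hH : IsFilterGain G S H)
    {L : ℕ → Mat p}
    (hL : ∀ k < G.n, H (k + 1) * G.innovCov S k * L (k + 1) = G.innovCov S k * L (k + 1))
    {k l : ℕ} (hk : k ≤ G.n) (hl : l ∈ Finset.Icc 1 k) :
    crossMoment μ (filterError G.A H x k) ((L l)ᵀ.toEuclideanLin ∘ x l) = 0 := by
  induction k with
  | zero => simp at hl
  | succ k ih =>
    rw [Finset.mem_Icc] at hl
    have hν : MemLp (innovation G.A H x k) 2 μ := hx.memLp_innovation hk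
    have hxl : MemLp (x l) 2 μ := hx.memLp_state (by lia)
    have hy := memLp_toEuclideanLin_comp hxl (L l)ᵀ
    rw [filterError_succ, crossMoment_toEuclideanLin_left hν hy]
    rcases hl.2.eq_or_lt with rfl | hlk
    · rw [crossMoment_toEuclideanLin_right hν hxl, hx.crossMoment_innovation_state hH hk,
        Matrix.transpose_transpose, Matrix.sub_mul, Matrix.one_mul, ← Matrix.mul_assoc, hL k hk,
        sub_self]
    · have hnoise : crossMoment μ (w k) ((L l)ᵀ.toEuclideanLin ∘ x l) = 0 := by
        rw [crossMoment_toEuclideanLin_right (hx.memLp_noise hk) hxl,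
          hx.crossMoment_noise_state (by lia) hk, Matrix.zero_mul]
      rw [hx.crossMoment_innovation hk hy (ih (by lia) (Finset.mem_Icc.2 (by lia))) hnoise,
        Matrix.mul_zero]

end IsStateProcess

end LinearFilter

section Gains

section ProjectionGain

variable {ι : Type*} [Fintype ι] [DecidableEq ι] {D P U E L : Matrix ι ι ℝ}

/-- The gain `D^{1/2} P D^{-1/2}` of a filter whose innovation has the covariance `D`, when the
normalized innovation `D^{-1/2} ν` is revealed through the projection `P`. -/
noncomputable def projectionGain (D P : Matrix ι ι ℝ) : Matrix ι ι ℝ :=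
  CFC.sqrt D * P * (CFC.sqrt D)⁻¹

theorem projectionGain_transpose (hP : Pᵀ = P) :
    (projectionGain D P)ᵀ = (CFC.sqrt D)⁻¹ * P * CFC.sqrt D := by
  rw [projectionGain, Matrix.transpose_mul, Matrix.transpose_mul, hP,
    transpose_eq_of_nonneg (inv_sqrt_nonneg D), transpose_eq_of_nonneg (CFC.sqrt_nonneg D),
    Matrix.mul_assoc]

theorem projectionGain_mul_self (hD : D.PosDef) :
    projectionGain D P * D = CFC.sqrt D * P * CFC.sqrt D := by
  calc projectionGain D P * D
      = projectionGain D P * (CFC.sqrt D * CFC.sqrt D) := by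
        rw [CFC.sqrt_mul_sqrt_self D hD.posSemidef.nonneg]
    _ = CFC.sqrt D * P * ((CFC.sqrt D)⁻¹ * CFC.sqrt D) * CFC.sqrt D := by
        simp only [projectionGain, Matrix.mul_assoc]
    _ = CFC.sqrt D * P * CFC.sqrt D := by rw [inv_sqrt_mul_sqrt hD, Matrix.mul_one]

theorem self_mul_projectionGain_transpose (hD : D.PosDef) (hP : Pᵀ = P) :
    D * (projectionGain D P)ᵀ = CFC.sqrt D * P * CFC.sqrt D := by
  have hDt : Dᵀ = D := transpose_eq_of_nonneg hD.posSemidef.nonneg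
  rw [← congrArg (· * _) hDt, ← Matrix.transpose_mul, projectionGain_mul_self hD,
    Matrix.transpose_mul, Matrix.transpose_mul, hP, transpose_eq_of_nonneg (CFC.sqrt_nonneg D),
    Matrix.mul_assoc]

theorem projectionGain_mul_mul_transpose (hD : D.PosDef) (hP : Pᵀ = P) (hPP : P * P = P) :
    projectionGain D P * D * (projectionGain D P)ᵀ = CFC.sqrt D * P * CFC.sqrt D := by
  calc projectionGain D P * D * (projectionGain D P)ᵀ
      = CFC.sqrt D * P * (CFC.sqrt D * (CFC.sqrt D)⁻¹) * P * CFC.sqrt D := by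
        simp only [projectionGain_mul_self hD, projectionGain_transpose hP, Matrix.mul_assoc]
    _ = CFC.sqrt D * P * CFC.sqrt D := by
        rw [sqrt_mul_inv_sqrt hD, Matrix.mul_one, Matrix.mul_assoc (CFC.sqrt D), hPP]

theorem projectionGain_eq_mul_transpose (hE : Eᵀ = E) :
    projectionGain D (U * E * Uᵀ) = CFC.sqrt D * U * ((CFC.sqrt D)⁻¹ * U * E)ᵀ := by
  rw [projectionGain, Matrix.transpose_mul, Matrix.transpose_mul, hE,
    transpose_eq_of_nonneg (inv_sqrt_nonneg D)]
  simp only [Matrix.mul_assoc]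

theorem projectionGain_mul_mul_eq (hD : D.PosDef) (hPP : P * P = P) (hU : Uᵀ * U = 1)
    (hP : P = U * E * Uᵀ) (hL : L = (CFC.sqrt D)⁻¹ * U * E) :
    projectionGain D P * D * L = D * L := by
  have hPU : U * E = P * U := by rw [hP, Matrix.mul_assoc _ _ U, hU, Matrix.mul_one]
  have hsqrtL : CFC.sqrt D * L = P * U := by
    rw [hL, Matrix.mul_assoc, hPU, ← Matrix.mul_assoc, sqrt_mul_inv_sqrt hD, Matrix.one_mul]
  calc projectionGain D P * D * L
      = CFC.sqrt D * (P * P) * U := by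
        rw [projectionGain_mul_self hD, Matrix.mul_assoc, hsqrtL]
        simp only [Matrix.mul_assoc]
    _ = CFC.sqrt D * (CFC.sqrt D * L) := by rw [hPP, hsqrtL, Matrix.mul_assoc]
    _ = D * L := by rw [← Matrix.mul_assoc, CFC.sqrt_mul_sqrt_self D hD.posSemidef.nonneg]

end ProjectionGain

variable {m p t q : ℕ} {G : Game m p t q} {S P : ℕ → Mat p}

/-- The gains of the linear filter for the posterior covariances `S` with the projections `P`.
The value at the stage `0`, where the filter is not updated, is irrelevant. -/
noncomputable def posteriorGain (G : Game m p t q) (S P : ℕ → Mat p) : ℕ → Mat p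
  | 0 => 0
  | k + 1 => projectionGain (G.innovCov S k) (P (k + 1))

theorem succ_mem_Icc_one {k n : ℕ} (hk : k < n) : k + 1 ∈ Finset.Icc 1 n :=
  Finset.mem_Icc.2 ⟨k.succ_pos, hk⟩

theorem IsStablePosteriorSeq.isFilterGain (hS : IsStablePosteriorSeq G S P)
    (hD : ∀ k < G.n, (G.innovCov S k).PosDef) : IsFilterGain G S (posteriorGain G S P) where
  zero := hS.zero
  recursion k hk := by
    obtain ⟨hP, hPP⟩ := hS.proj (k + 1) (succ_mem_Icc_one hk)
    rw [posteriorGain, projectionGain_mul_mul_transpose (hD k hk) hP hPP, hS.recursion k hk]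
  proj k hk := by
    obtain ⟨hP, hPP⟩ := hS.proj (k + 1) (succ_mem_Icc_one hk)
    rw [posteriorGain, projectionGain_mul_mul_transpose (hD k hk) hP hPP,
      self_mul_projectionGain_transpose (hD k hk) hP]

end Gains

section Information

variable {m p t : ℕ} {Ω : Type*} {x : ℕ → Ω → Vec p}

/-- The σ-algebra generated by the receiver's information at stage `k`. -/
abbrev infoAlgebra (η : Profile m p) (x : ℕ → Ω → Vec p) (k : ℕ) : MeasurableSpace Ω :=
  MeasurableSpace.comap (info η x k) inferInstance

theorem infoAlgebra_mono (η : Profile m p) (x : ℕ → Ω → Vec p) : Monotone (infoAlgebra η x) := by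
  intro k l hkl
  have hrestrict : info η x k = (fun (f : Fin m → Finset.Icc 1 l → Vec p) i (j : Finset.Icc 1 k) =>
      f i ⟨j, Finset.Icc_subset_Icc_right hkl j.2⟩) ∘ info η x l := rfl
  rw [infoAlgebra, hrestrict, ← MeasurableSpace.comap_comp]
  exact MeasurableSpace.comap_mono (Measurable.comap_le (by fun_prop))

theorem infoAlgebra_const_le_update (hm : 2 ≤ m) (η₀ : SenderPolicy p) (x : ℕ → Ω → Vec p) (k : ℕ)
    (i : Fin m) (ηi : SenderPolicy p) :
    infoAlgebra (fun _ : Fin m => η₀) x k ≤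
      infoAlgebra (Function.update (fun _ => η₀) i ηi) x k := by
  have : Nontrivial (Fin m) := Fin.nontrivial_iff_two_le.2 hm
  obtain ⟨j, hj⟩ := exists_ne i
  have hcopy : info (fun _ : Fin m => η₀) x k
      = (fun (f : Fin m → Finset.Icc 1 k → Vec p) (_ : Fin m) l => f j l)
        ∘ info (Function.update (fun _ => η₀) i ηi) x k := by
    funext ω _ l
    simp only [info, Function.comp_apply, Function.update_of_ne hj]
  rw [infoAlgebra, hcopy, ← MeasurableSpace.comap_comp]
  exact MeasurableSpace.comap_mono (Measurable.comap_le (by fun_prop))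

theorem stronglyMeasurable_signal (η : Profile m p) (i : Fin m) {k : ℕ} (hk : 1 ≤ k) :
    StronglyMeasurable[infoAlgebra η x k] (signal (η i) x k) := by
  have heval : Measurable fun f : Fin m → Finset.Icc 1 k → Vec p =>
      f i ⟨k, Finset.mem_Icc.2 ⟨hk, le_rfl⟩⟩ := by fun_prop
  exact (heval.comp (comap_measurable (info η x k))).stronglyMeasurable

theorem stronglyMeasurable_action (η : Profile m p) (γ : ReceiverPolicy m p t) (k : ℕ) :
    StronglyMeasurable[infoAlgebra η x k] (action η γ x k) :=
  ((γ.measurable k).comp (comap_measurable (info η x k))).stronglyMeasurable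

theorem signal_linearPolicy (L : ℕ → Mat p) {k : ℕ} (hk : 1 ≤ k) :
    signal (linearPolicy L) x k = (L k)ᵀ.toEuclideanLin ∘ x k := by
  funext ω
  simp [signal, linearPolicy, hk]

theorem stronglyMeasurable_linearFilter (hm : 0 < m) {A : Mat p} {H L M : ℕ → Mat p} {k : ℕ}
    (hM : ∀ l < k, H (l + 1) = M l * (L (l + 1))ᵀ) :
    StronglyMeasurable[infoAlgebra (fun _ : Fin m => linearPolicy L) x k]
      (linearFilter A H x k) := by
  induction k with
  | zero => exact stronglyMeasurable_const
  | succ k ih =>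
    have hcont (N : Mat p) : Continuous N.toEuclideanLin :=
      LinearMap.continuous_of_finiteDimensional _
    have hsignal := stronglyMeasurable_signal (x := x) (fun _ => linearPolicy L) (⟨0, hm⟩ : Fin m)
      k.succ_pos
    rw [signal_linearPolicy L k.succ_pos] at hsignal
    have hpred := (hcont A).comp_stronglyMeasurable ((ih fun l hl => hM l (by lia)).mono
      (infoAlgebra_mono (fun _ : Fin m => linearPolicy L) x k.le_succ))
    have hgain : (H (k + 1)).toEuclideanLin ∘ innovation A H x k
        = (M k).toEuclideanLin ∘ ((L (k + 1))ᵀ.toEuclideanLin ∘ x (k + 1)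
          - (L (k + 1))ᵀ.toEuclideanLin ∘ A.toEuclideanLin ∘ linearFilter A H x k) := by
      funext ω
      simp only [hM k k.lt_succ_self, innovation, Matrix.toLpLin_mul_same, LinearMap.comp_apply,
        Function.comp_apply, Pi.sub_apply, map_sub]
    rw [linearFilter_succ, hgain]
    exact hpred.add ((hcont _).comp_stronglyMeasurable
      (hsignal.sub ((hcont _).comp_stronglyMeasurable hpred)))

end Information

section BestResponse

variable {m p t q : ℕ} {Ω : Type*} [MeasurableSpace Ω] {μ : Measure Ω} {G : Game m p t q}
  {x w : ℕ → Ω → Vec p} {η : Profile m p} {γ : ReceiverPolicy m p t}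

/-- The action at stage `k` of a receiver that best responds to `η`. -/
noncomputable def bestAction (G : Game m p t q) (μ : Measure Ω) (x : ℕ → Ω → Vec p)
    (η : Profile m p) (k : ℕ) : Ω → Vec t :=
  optimalAction μ (infoAlgebra η x k) (G.Qr k) (G.Rr k) (x k)

theorem exists_action_eq_bestAction (G : Game m p t q) (μ : Measure Ω) (x : ℕ → Ω → Vec p)
    (η : Profile m p) :
    ∃ γ : ReceiverPolicy m p t, ∀ k, action η γ x k = bestAction G μ x η k := by
  have hfactor (k) : ∃ g : (Fin m → Finset.Icc 1 k → Vec p) → Vec t, StronglyMeasurable g ∧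
      bestAction G μ x η k = g ∘ info η x k :=
    stronglyMeasurable_optimalAction.exists_eq_measurable_comp
  choose g hg hg' using hfactor
  exact ⟨⟨g, fun k => (hg k).measurable⟩, fun k => (hg' k).symm⟩

namespace IsStateProcess

theorem measurable_info (hx : IsStateProcess G μ x w) (η : Profile m p) {k : ℕ} (hk : k ≤ G.n) :
    Measurable (info η x k) := by
  refine measurable_pi_iff.2 fun i => measurable_pi_iff.2 fun j => ?_
  refine ((η i).measurable j).comp (measurable_pi_iff.2 fun l => hx.measurable_state ?_)
  exact (Finset.mem_Icc.1 l.2).2.trans ((Finset.mem_Icc.1 j.2).2.trans hk)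

theorem infoAlgebra_le (hx : IsStateProcess G μ x w) (η : Profile m p) {k : ℕ} (hk : k ≤ G.n) :
    infoAlgebra η x k ≤ ‹MeasurableSpace Ω› :=
  (hx.measurable_info η hk).comap_le

theorem cost_eq_sum (hx : IsStateProcess G μ x w) (Q : ℕ → Matrix (Fin q) (Fin p) ℝ)
    (R : ℕ → Matrix (Fin q) (Fin t) ℝ) {K : ℕ} (hK : K ≤ G.n) (η : Profile m p)
    (γ : ReceiverPolicy m p t) : cost μ x Q R K η γ
      = ∑ k ∈ Finset.Icc 1 K, stageCost μ (Q k) (R k) (x k) (action η γ x k) := by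
  refine lintegral_finsetSum _ fun k hk => ?_
  have hkn : k ≤ G.n := (Finset.mem_Icc.1 hk).2.trans hK
  have hQx := (LinearMap.continuous_of_finiteDimensional (Q k).toEuclideanLin).measurable.comp
    (hx.measurable_state hkn)
  have hRu := (LinearMap.continuous_of_finiteDimensional (R k).toEuclideanLin).measurable.comp
    ((γ.measurable k).comp (hx.measurable_info η hkn))
  exact ((hQx.add hRu).norm.pow_const 2).ennreal_ofReal

theorem stageCost_bestAction_le (hx : IsStateProcess G μ x w) (η : Profile m p)
    (γ : ReceiverPolicy m p t) {k : ℕ} (hk : k ∈ Finset.Icc 1 G.n) :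
    stageCost μ (G.Qr k) (G.Rr k) (x k) (bestAction G μ x η k)
      ≤ stageCost μ (G.Qr k) (G.Rr k) (x k) (action η γ x k) := by
  have := hx.isProbabilityMeasure
  have hkn := (Finset.mem_Icc.1 hk).2
  exact stageCost_optimalAction_le (hx.infoAlgebra_le η hkn) (G.Rr_invertible k hk)
    (hx.memLp_state hkn) (stronglyMeasurable_action η γ k)

theorem action_ae_eq_bestAction_of_stageCost_le (hx : IsStateProcess G μ x w) {k : ℕ}
    (hk : k ∈ Finset.Icc 1 G.n)
    (h : stageCost μ (G.Qr k) (G.Rr k) (x k) (action η γ x k)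
      ≤ stageCost μ (G.Qr k) (G.Rr k) (x k) (bestAction G μ x η k)) :
    action η γ x k =ᵐ[μ] bestAction G μ x η k := by
  have := hx.isProbabilityMeasure
  have hkn := (Finset.mem_Icc.1 hk).2
  exact ae_eq_optimalAction_of_stageCost_le (hx.infoAlgebra_le η hkn) (G.Rr_invertible k hk)
    (hx.memLp_state hkn) (stronglyMeasurable_action η γ k) h

theorem exists_isBestResponse (hx : IsStateProcess G μ x w) (η : Profile m p) :
    ∃ γ : ReceiverPolicy m p t, IsBestResponse G μ x η γ := by
  obtain ⟨γ, hγ⟩ := exists_action_eq_bestAction G μ x η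
  refine ⟨γ, fun K hK γ' => ?_⟩
  have hKn := (Finset.mem_Icc.1 hK).2
  rw [hx.cost_eq_sum _ _ hKn, hx.cost_eq_sum _ _ hKn]
  refine Finset.sum_le_sum fun k hk => ?_
  rw [hγ]
  exact hx.stageCost_bestAction_le η γ' (Finset.Icc_subset_Icc_right hKn hk)

theorem action_ae_eq_bestAction (hx : IsStateProcess G μ x w) (hγ : IsBestResponse G μ x η γ)
    {k : ℕ} (hk : k ∈ Finset.Icc 1 G.n) : action η γ x k =ᵐ[μ] bestAction G μ x η k := by
  refine hx.action_ae_eq_bestAction_of_stageCost_le hk ?_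
  let c (u : ℕ → Ω → Vec t) (l : ℕ) : ℝ≥0∞ := stageCost μ (G.Qr l) (G.Rr l) (x l) (u l)
  obtain ⟨γ', hγ'⟩ := exists_action_eq_bestAction G μ x η
  have htotal : ∑ l ∈ Finset.Icc 1 G.n, c (action η γ x) l
      ≤ ∑ l ∈ Finset.Icc 1 G.n, c (bestAction G μ x η) l := by
    have hn : G.n ∈ Finset.Icc 1 G.n :=
      Finset.mem_Icc.2 ⟨(Finset.mem_Icc.1 hk).1.trans (Finset.mem_Icc.1 hk).2, le_rfl⟩
    have h := hγ G.n hn γ'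
    rwa [hx.cost_eq_sum _ _ le_rfl, hx.cost_eq_sum _ _ le_rfl, funext hγ'] at h
  have hrest : ∑ l ∈ (Finset.Icc 1 G.n).erase k, c (bestAction G μ x η) l
      ≤ ∑ l ∈ (Finset.Icc 1 G.n).erase k, c (action η γ x) l :=
    Finset.sum_le_sum fun l hl => hx.stageCost_bestAction_le η γ (Finset.mem_of_mem_erase hl)
  have hfin : ∑ l ∈ (Finset.Icc 1 G.n).erase k, c (bestAction G μ x η) l ≠ ∞ := by
    refine ENNReal.sum_ne_top.2 fun l hl => ?_
    have hxl := hx.memLp_state (Finset.mem_Icc.1 (Finset.mem_of_mem_erase hl)).2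
    exact (stageCost_lt_top hxl (memLp_optimalAction hxl)).ne
  rw [← Finset.add_sum_erase _ _ hk, ← Finset.add_sum_erase _ _ hk] at htotal
  exact (ENNReal.add_le_add_iff_right hfin).1 ((add_le_add_right hrest _).trans htotal)

theorem cost_of_isBestResponse (hx : IsStateProcess G μ x w) (hγ : IsBestResponse G μ x η γ)
    (i : Fin m) {K : ℕ} (hK : K ≤ G.n) :
    cost μ x (G.Q i) (G.R i) K η γ = ∑ k ∈ Finset.Icc 1 K,
      ENNReal.ofReal (((G.Q i k)ᵀ * G.Q i k * G.stateCov k).trace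
        + (G.V i k * posteriorCov μ x η k).trace) := by
  have := hx.isProbabilityMeasure
  rw [hx.cost_eq_sum _ _ hK]
  refine Finset.sum_congr rfl fun k hk => ?_
  have hkn : k ≤ G.n := (Finset.mem_Icc.1 hk).2.trans hK
  rw [stageCost_congr (hx.action_ae_eq_bestAction hγ (Finset.Icc_subset_Icc_right hK hk)),
    ← hx.crossMoment_state hkn]
  exact stageCost_optimalAction (hx.infoAlgebra_le η hkn) (hx.memLp_state hkn) _ _ rfl

end IsStateProcess

end BestResponse

section Equilibrium

variable {m p t q : ℕ} {Ω : Type*} [MeasurableSpace Ω] {μ : Measure Ω} {G : Game m p t q}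
  {x w : ℕ → Ω → Vec p} {S P H L M U : ℕ → Mat p} {k : ℕ}

namespace IsStateProcess

theorem posteriorCov_le_stateCov (hx : IsStateProcess G μ x w) (η : Profile m p) (hk : k ≤ G.n) :
    posteriorCov μ x η k ≤ G.stateCov k := by
  have := hx.isProbabilityMeasure
  rw [← hx.crossMoment_state hk]
  exact crossMoment_condExp_le_self (hx.infoAlgebra_le η hk) (hx.memLp_state hk)

theorem posteriorCov_mono (hx : IsStateProcess G μ x w) {η η' : Profile m p} (hk : k ≤ G.n)
    (h : infoAlgebra η x k ≤ infoAlgebra η' x k) :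
    posteriorCov μ x η k ≤ posteriorCov μ x η' k := by
  have := hx.isProbabilityMeasure
  exact crossMoment_condExp_mono h (hx.infoAlgebra_le η' hk) (hx.memLp_state hk)

theorem isMultistageNash (hx : IsStateProcess G μ x w) (hm : 2 ≤ m) {η₀ : SenderPolicy p}
    (hS : ∀ k ∈ Finset.Icc 1 G.n, ∀ i,
      IsStable (G.stateCov k) (G.V i k) (posteriorCov μ x (fun _ : Fin m => η₀) k))
    {γ : Profile m p → ReceiverPolicy m p t} (hγ : ∀ η, IsBestResponse G μ x η (γ η)) :
    IsMultistageNash G μ x (fun _ => η₀) γ := by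
  refine ⟨hγ, fun K hK i ηi => ?_⟩
  have hKn := (Finset.mem_Icc.1 hK).2
  rw [hx.cost_of_isBestResponse (hγ _) i hKn, hx.cost_of_isBestResponse (hγ _) i hKn]
  refine Finset.sum_le_sum fun k hk => ENNReal.ofReal_le_ofReal (add_le_add_right ?_ _)
  have hk' := Finset.Icc_subset_Icc_right hKn hk
  have hkn := (Finset.mem_Icc.1 hk').2
  exact (hS k hk' i).2.2 _ (hx.posteriorCov_mono hkn (infoAlgebra_const_le_update hm η₀ x k i ηi))
    (hx.posteriorCov_le_stateCov _ hkn)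

theorem indepFun_filterError_info (hx : IsStateProcess G μ x w) (hH : IsFilterGain G S H)
    (hL : ∀ k < G.n, H (k + 1) * G.innovCov S k * L (k + 1) = G.innovCov S k * L (k + 1))
    (hk : k ≤ G.n) :
    IndepFun (filterError G.A H x k) (info (fun _ : Fin m => linearPolicy L) x k) μ := by
  have hindep := (hx.isLinearImage_filterError (A := G.A) (H := H) hk).indepFun
    (Y := fun (j : Finset.Icc 1 k) => (L j)ᵀ.toEuclideanLin ∘ x j)
    (fun j => (hx.isLinearImage_state ((Finset.mem_Icc.1 j.2).2.trans hk)).map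
      (L j)ᵀ.toEuclideanLin.toContinuousLinearMap)
    hx.hasGaussianLaw_driver hx.integral_driver
    fun j => hx.crossMoment_filterError_signal hH hL hk j.2
  have hinfo : info (fun _ : Fin m => linearPolicy L) x k
      = (fun (f : Finset.Icc 1 k → Vec p) (_ : Fin m) => f)
        ∘ fun ω (j : Finset.Icc 1 k) => ((L j)ᵀ.toEuclideanLin ∘ x j) ω := by
    funext ω i j
    exact congrFun (signal_linearPolicy L (Finset.mem_Icc.1 j.2).1) ω
  rw [hinfo]
  exact hindep.comp measurable_id (by fun_prop)

theorem estimate_ae_eq_linearFilter (hx : IsStateProcess G μ x w) (hm : 0 < m)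
    (hH : IsFilterGain G S H) (hM : ∀ k < G.n, H (k + 1) = M k * (L (k + 1))ᵀ)
    (hL : ∀ k < G.n, H (k + 1) * G.innovCov S k * L (k + 1) = G.innovCov S k * L (k + 1))
    (hk : k ≤ G.n) :
    estimate μ x (fun _ : Fin m => linearPolicy L) k =ᵐ[μ] linearFilter G.A H x k := by
  have := hx.isProbabilityMeasure
  have hle := hx.infoAlgebra_le (fun _ : Fin m => linearPolicy L) hk
  have hfm := stronglyMeasurable_linearFilter (x := x) (A := G.A) hm
    fun l hl => hM l (hl.trans_le hk)
  have hf : Integrable (linearFilter G.A H x k) μ :=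
    (hx.memLp_linearFilter hk).integrable one_le_two
  have he : Integrable (filterError G.A H x k) μ := (hx.memLp_filterError hk).integrable one_le_two
  have hem : Measurable (filterError G.A H x k) :=
    (hx.measurable_state hk).sub (hfm.mono hle).measurable
  have herror := condExp_indep_eq hem.comap_le hle (comap_measurable _).stronglyMeasurable
    ((IndepFun_iff_Indep _ _ _).1 (hx.indepFun_filterError_info hH hL hk))
  have hsplit := condExp_add hf he (infoAlgebra (fun _ : Fin m => linearPolicy L) x k)
  rw [filterError, add_sub_cancel, condExp_of_stronglyMeasurable hle hfm hf, ← filterError]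
    at hsplit
  filter_upwards [hsplit, herror] with ω hω hω'
  rw [estimate, hω, Pi.add_apply, hω',
    hx.integral_of_isLinearImage (hx.isLinearImage_filterError hk), add_zero]

theorem posteriorCov_linearPolicy (hx : IsStateProcess G μ x w) (hm : 0 < m)
    (hS : IsStablePosteriorSeq G S P) (hD : ∀ k < G.n, (G.innovCov S k).PosDef)
    {d : ℕ → Fin p → ℝ}
    (hU : ∀ k ∈ Finset.Icc 1 G.n, U k ∈ Matrix.orthogonalGroup (Fin p) ℝ ∧
      P k = U k * Matrix.diagonal (d k) * (U k)ᵀ)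
    (hL : ∀ k < G.n, L (k + 1) =
      (CFC.sqrt (G.innovCov S k))⁻¹ * U (k + 1) * Matrix.diagonal (d (k + 1)))
    (hk : k ≤ G.n) :
    posteriorCov μ x (fun _ : Fin m => linearPolicy L) k = S k := by
  have hH := hS.isFilterGain hD
  have hfilter := hx.estimate_ae_eq_linearFilter (L := L)
    (M := fun k => CFC.sqrt (G.innovCov S k) * U (k + 1)) hm hH
    (fun k hk => by
      rw [posteriorGain, (hU _ (succ_mem_Icc_one hk)).2, hL k hk,
        projectionGain_eq_mul_transpose (Matrix.diagonal_transpose _)])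
    (fun k hk => by
      obtain ⟨hUk, hPk⟩ := hU _ (succ_mem_Icc_one hk)
      exact projectionGain_mul_mul_eq (hD k hk) (hS.proj _ (succ_mem_Icc_one hk)).2
        ((Matrix.mem_orthogonalGroup_iff' _ _).1 hUk) hPk (hL k hk)) hk
  exact (crossMoment_congr hfilter hfilter).trans
    (hx.crossMoment_linearFilter_and_filterError hH hk).1

end IsStateProcess

end Equilibrium

end Disclosure

theorem lemma9 {m p t q : ℕ} (hm : 2 ≤ m) (G : Disclosure.Game m p t q)
    {Ω : Type*} [MeasurableSpace Ω] (μ : Measure Ω) [IsProbabilityMeasure μ]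
    (x w : ℕ → Ω → Disclosure.Vec p) (hx : Disclosure.IsStateProcess G μ x w) :
    -- the common linear policy attains every sequence of stable posteriors, in equilibrium
    (∀ S P U : ℕ → Disclosure.Mat p, ∀ d : ℕ → Fin p → ℝ, ∀ L : ℕ → Disclosure.Mat p,
      Disclosure.IsStablePosteriorSeq G S P →
      (∀ k < G.n, (G.innovCov S k).PosDef) →
      (∀ k ∈ Finset.Icc 1 G.n, U k ∈ Matrix.orthogonalGroup (Fin p) ℝ ∧
        P k = U k * Matrix.diagonal (d k) * (U k)ᵀ) →
      (∀ k < G.n, L (k + 1) =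
        (CFC.sqrt (G.innovCov S k))⁻¹ * U (k + 1) * Matrix.diagonal (d (k + 1))) →
      (∀ k ∈ Finset.Icc 1 G.n,
        Disclosure.posteriorCov μ x (fun _ : Fin m => Disclosure.linearPolicy L) k = S k) ∧
      (∃ γ, Disclosure.IsMultistageNash G μ x (fun _ => Disclosure.linearPolicy L) γ) ∧
      ∀ γ : Disclosure.Profile m p → Disclosure.ReceiverPolicy m p t,
        (∀ η, Disclosure.IsBestResponse G μ x η (γ η)) →
        Disclosure.IsMultistageNash G μ x (fun _ => Disclosure.linearPolicy L) γ) ∧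
    -- the outcomes of the greedy algorithm are such sequences
    (∀ (o : Equiv.Perm (Fin m)) (S : ℕ → Disclosure.Mat p), Disclosure.IsGreedyOutput G o S →
      (∀ k < G.n, (G.innovCov S k).PosDef) →
      ∃ P : ℕ → Disclosure.Mat p, Disclosure.IsStablePosteriorSeq G S P) := by
  refine ⟨fun S P U d L hS hD hU hL => ?_, fun o S hS hD => hS.exists_isStablePosteriorSeq hD⟩
  have hcov : ∀ k ∈ Finset.Icc 1 G.n,
      Disclosure.posteriorCov μ x (fun _ : Fin m => Disclosure.linearPolicy L) k = S k :=
    fun k hk => hx.posteriorCov_linearPolicy (by lia) hS hD hU hL (Finset.mem_Icc.1 hk).2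
  have hstable : ∀ k ∈ Finset.Icc 1 G.n, ∀ i, Disclosure.IsStable (G.stateCov k) (G.V i k)
      (Disclosure.posteriorCov μ x (fun _ : Fin m => Disclosure.linearPolicy L) k) :=
    fun k hk i => by
      rw [hcov k hk]
      exact hS.stable k hk i
  choose γ hγ using hx.exists_isBestResponse
  exact ⟨hcov, ⟨γ, hx.isMultistageNash hm hstable hγ⟩,
    fun γ hγ => hx.isMultistageNash hm hstable hγ⟩
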